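/- **Basic $T$-Lie algebras.** Let $k$ be a commutative ring with $1$ and $L$ a free $k$-module with a totally ordered basis $\mathcal B$. Let $S,T,\langle\,,\rangle:L\otimes_kL\to L\otimes_kL$ and $[\,,]:L\otimes_kL\to L$ be $k$-linear, and let $\eta:\mathcal B\to\{1,2,\dots\}$. Put $L_m=\operatorname{span}\{x\in\mathcal B:\eta(x)=m\}$, so that $L=\bigoplus_m L_m$; $S_{12}=S\otimes \mathrm{Id}$, $S_{23}=\mathrm{Id}\otimes S$; and let $L^3$ (resp. ${}^3L$) be the span in $L^{\otimes3}$ of the $x\otimes y\otimes z$ with $x<y<z$ (resp. $x>y>z$) in $\mathcal B$. Then $L$ is a *basic $T$-Lie algebra* (with grading $\eta$) if 1. $S^2=\mathrm{Id}$; $S(x\otimes y)=q_{x,y}\,y\otimes x$ with $q_{x,y}\in k$ for all $x,y\in\mathcal B$; and on $L^3$ $S(\mathrm{Id}\otimes[\,,])=([\,,]\otimes \mathrm{Id})S_{23}S_{12}$ and $S([\,,]\otimes \mathrm{Id})=(\mathrm{Id}\otimes[\,,])S_{12}S_{23}$; 2. $[L_{m_1},L_{m_2}]\subseteq\bigoplus_{m\le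 m_1+m_2-1}L_m$ and $\langle L_{m_1}\otimes L_{m_2}\rangle\subseteq\bigoplus_{m+m'\le m_1+m_2-1}L_m\otimes L_{m'}$ for all $m_1,m_2$; 3. $T=S+\langle\,,\rangle$; 4. $[\,,]T=-[\,,]$, $\ \langle\,,\rangle S=-\langle\,,\rangle$, $\ [\,,]\langle\,,\rangle=0$; 5. $[\,,]\bigl((\mathrm{Id}\otimes[\,,])S_{12}S_{23}-([\,,]\otimes \mathrm{Id})S_{23}S_{12}+(\mathrm{Id}\otimes[\,,])S_{23}S_{12}\bigr)=0$ on ${}^3L$. **Adequacy.** Let $\mathcal P=\mathcal S(L)$ be the $q$-symmetric algebra: the tensor algebra of $L$ modulo the two-sided ideal generated by $x\otimes y-S(x\otimes y)$, $x,y\in\mathcal B$. Write $z_x$ for the image of $x\in\mathcal B$ in $\mathcal P$. For a finite non-decreasing sequence $\Sigma=(x_1\le\dots\le x_u)$ in $\mathcal B$ put $z_\Sigma=z_{x_1}\cdots z_{x_u}$ ($z_\emptyset=1$), $\eta(\Sigma)=\sum_i\eta(x_i)$, and write $x\le\Sigma$ if $\Sigma=\emptyset$ or $x\le x_1$. Let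 $\mathcal P_p=\operatorname{span}\{z_\Sigma:\eta(\Sigma)\le p\}$. For a $k$-linear map $L\otimes_k\mathcal P\to\mathcal P$, $x\otimes v\mapsto x\cdot v$, write $(x\otimes y)\cdot v=x\cdot(y\cdot v)$, and consider the conditions, for $x\in\mathcal B$ and $\Sigma$ non-decreasing, * (A) $x\cdot z_\Sigma=z_xz_\Sigma$ if $x\le\Sigma$; * (B) $x\cdot z_\Sigma-z_xz_\Sigma\in\mathcal P_{\eta(x)+\eta(\Sigma)-1}$; * (R) if $x>y\in\mathcal B$ and $(y,N)$ is non-decreasing, then $x\cdot z_{(y,N)}=q_{x,y}z_yz_xz_N+q_{x,y}\,y\cdot(x\cdot z_N-z_xz_N)+\langle x,y\rangle\cdot z_N+[x,y]\cdot z_N$. $L$ is *adequate* if a $k$-linear map satisfying (A), (B), (R) exists and, for it, and indeed for every $k$-linear map satisfying (A) and (B), the following holds for every $r\in\mathbb N$: if $$x\cdot y\cdot z_M-T(x\otimes y)\cdot z_M=[x,y]\cdot z_M$$ for all $x,y\in\mathcal B$ and non-decreasing $M$ with $\eta(x)+\eta(y)+\eta(M)\le r$, then for all $\lambda>\mu>\gamma$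 in $\mathcal B$ and all non-decreasing $N$ with $\gamma\le N$ and $\eta(\lambda)+\eta(\mu)+\eta(\gamma)+\eta(N)\le r+1$, $$\begin{aligned} &\langle \lambda,\mu\rangle\cdot\gamma\cdot z_N-q_{\lambda,\mu}[\mu,[\lambda,\gamma]]\cdot z_N\\ &=q_{\mu,\gamma}q_{\lambda,\gamma}\langle\gamma,[\lambda,\mu]\rangle\cdot z_N+q_{\mu,\gamma}q_{\lambda,\gamma}\,\gamma\cdot\langle\lambda,\mu\rangle\cdot z_N\\ &\quad+q_{\mu,\gamma}\langle\lambda,\gamma\rangle\cdot\mu\cdot z_N-q_{\lambda,\mu}\,\mu\cdot\langle\lambda,\gamma\rangle\cdot z_N\\ &\quad+q_{\mu,\gamma}[\lambda,\gamma]\cdot\mu\cdot z_N-q_{\lambda,\mu}\,\mu\cdot[\lambda,\gamma]\cdot z_N\\ &\quad+\lambda\cdot\langle\mu,\gamma\rangle\cdot z_N-q_{\lambda,\mu}q_{\lambda,\gamma}\langle\mu,\gamma\rangle\cdot\lambda\cdot z_N-q_{\lambda,\gamma}q_{\lambda,\mu}\langle[\mu,\gamma],\lambda\rangle\cdot z_N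 . \end{aligned}$$ **The algebra $(sl_{n+1}^+)_q$.** Let $\mathbb K$ be a field of characteristic $0$, $q=\exp(t)\in\mathbb K[[t]]$, $k=\mathbb K[q,q^{-1}]\subseteq\mathbb K[[t]]$, and $n\ge0$. Let $(sl_{n+1}^+)_q$ be the free $k$-module with basis $\mathcal B=\{e_{ij}:1\le i<j\le n+1\}$, ordered by $e_{ab}<e_{uv}$ iff $a+b<u+v$, or $a+b=u+v$ and $b<v$. For $x=e_{ab}$, $y=e_{uv}$ let $[x,y]=\delta_{bu}e_{av}-\delta_{va}e_{ub}$ be the matrix commutator and $c_{x,y}=\delta_{au}-\delta_{bu}-\delta_{av}+\delta_{bv}$ the integer with $[e_{aa}-e_{bb},y]=c_{x,y}y$. Define * $S(x\otimes y)=q_{x,y}\,y\otimes x$ with $q_{x,y}=q^{c_{x,y}}$ if $x<y$, $q_{x,y}=q^{-c_{y,x}}$ if $x>y$, $q_{x,x}=1$; * $[x,y]_q=[x,y]$ if $x<y$, $[x,y]_q=-q_{x,y}[y,x]$ if $x>y$, $[x,x]_q=0$; * $\langle e_{ij},e_{uv}\rangle=(q-q^{-1})\,e_{iv}\otimes e_{uj}$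 if $i<u<j<v$; $\ =(q^{-1}-q)\,e_{uj}\otimes e_{iv}$ if $u<i<v<j$; $\ =0$ otherwise; * $T=S+\langle\,,\rangle$ and $\eta(e_{ij})=i(j-i)$. **Theorem.** For every $n$, $(sl_{n+1}^+)_q$ with presymmetry $S$, symmetry $T$, pseudobracket $\langle\,,\rangle$, bracket $[\,,]_q$ and grading $\eta$ is an adequate basic $T$-Lie algebra. -/

import Mathlib

open scoped TensorProduct

noncomputable section

namespace TLie

/-! ## Basic T-Lie algebras -/

/-- The structure maps of a T-Lie algebra on a module `L`: presymmetry `S`, symmetry `T`,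
pseudobracket `⟨ , ⟩` and bracket `[ , ]`. -/
structure Data (k L : Type*) [CommRing k] [AddCommGroup L] [Module k L] where
  S : L ⊗[k] L →ₗ[k] L ⊗[k] L
  T : L ⊗[k] L →ₗ[k] L ⊗[k] L
  pseudo : L ⊗[k] L →ₗ[k] L ⊗[k] L
  bracket : L ⊗[k] L →ₗ[k] L

section General

variable {k L ι : Type*} [CommRing k] [AddCommGroup L] [Module k L]

/-- `f ⊗ Id` on `L ⊗ L ⊗ L`, for `f : L ⊗ L → L ⊗ L`. -/
def op12 (f : L ⊗[k] L →ₗ[k] L ⊗[k] L) : (L ⊗[k] L) ⊗[k] L →ₗ[k] (L ⊗[k] L) ⊗[k] L :=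
  f.rTensor L

/-- `Id ⊗ f` on `L ⊗ L ⊗ L`, for `f : L ⊗ L → L ⊗ L`. -/
def op23 (f : L ⊗[k] L →ₗ[k] L ⊗[k] L) : (L ⊗[k] L) ⊗[k] L →ₗ[k] (L ⊗[k] L) ⊗[k] L :=
  (TensorProduct.assoc k L L L).symm.toLinearMap ∘ₗ f.lTensor L ∘ₗ
    (TensorProduct.assoc k L L L).toLinearMap

/-- `[ , ] ⊗ Id : L ⊗ L ⊗ L → L ⊗ L`. -/
def brId (br : L ⊗[k] L →ₗ[k] L) : (L ⊗[k] L) ⊗[k] L →ₗ[k] L ⊗[k] L :=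
  br.rTensor L

/-- `Id ⊗ [ , ] : L ⊗ L ⊗ L → L ⊗ L`. -/
def idBr (br : L ⊗[k] L →ₗ[k] L) : (L ⊗[k] L) ⊗[k] L →ₗ[k] L ⊗[k] L :=
  br.lTensor L ∘ₗ (TensorProduct.assoc k L L L).toLinearMap

/-- `L³`, spanned by the `x ⊗ y ⊗ z` with `x < y < z` in the basis. -/
def increasing3 [LinearOrder ι] (b : Module.Basis ι k L) : Submodule k ((L ⊗[k] L) ⊗[k] L) :=
  Submodule.span k {t | ∃ x y z : ι, x < y ∧ y < z ∧ t = (b x ⊗ₜ[k] b y) ⊗ₜ[k] b z}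

/-- `³L`, spanned by the `x ⊗ y ⊗ z` with `x > y > z` in the basis. -/
def decreasing3 [LinearOrder ι] (b : Module.Basis ι k L) : Submodule k ((L ⊗[k] L) ⊗[k] L) :=
  Submodule.span k {t | ∃ x y z : ι, y < x ∧ z < y ∧ t = (b x ⊗ₜ[k] b y) ⊗ₜ[k] b z}

/-- `L_m`, spanned by the basis elements of degree `m`. -/
def gradedPart (b : Module.Basis ι k L) (η : ι → ℕ) (m : ℕ) : Submodule k L :=
  Submodule.span k (b '' {i | η i = m})

/-- The sum of the `L_m` with `m ≤ s - 1`. -/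
def gradedBelow (b : Module.Basis ι k L) (η : ι → ℕ) (s : ℕ) : Submodule k L :=
  ⨆ m : {m : ℕ // m + 1 ≤ s}, gradedPart b η m

/-- The sum of the `L_{m₁} ⊗ L_{m₂}` (inside `L ⊗ L`) with `m₁ + m₂ ≤ s - 1`. -/
def tensorGradedBelow (b : Module.Basis ι k L) (η : ι → ℕ) (s : ℕ) : Submodule k (L ⊗[k] L) :=
  ⨆ m : {m : ℕ × ℕ // m.1 + m.2 + 1 ≤ s},
    Submodule.map₂ (TensorProduct.mk k L L) (gradedPart b η m.1.1) (gradedPart b η m.1.2)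

/-- `L` with basis `b`, maps `D` and degrees `η` (with positive values on the basis) is a
basic T-Lie algebra. -/
structure IsBasicTLieAlgebra [LinearOrder ι] (b : Module.Basis ι k L) (D : Data k L)
    (η : ι → ℕ) : Prop where
  S_sq : D.S ∘ₗ D.S = LinearMap.id
  S_basis : ∃ q : ι → ι → k, ∀ x y : ι, D.S (b x ⊗ₜ[k] b y) = q x y • (b y ⊗ₜ[k] b x)
  mult_left : Set.EqOn (D.S ∘ₗ idBr D.bracket) (brId D.bracket ∘ₗ op23 D.S ∘ₗ op12 D.S)
    (increasing3 b : Set ((L ⊗[k] L) ⊗[k] L))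
  mult_right : Set.EqOn (D.S ∘ₗ brId D.bracket) (idBr D.bracket ∘ₗ op12 D.S ∘ₗ op23 D.S)
    (increasing3 b : Set ((L ⊗[k] L) ⊗[k] L))
  η_pos : ∀ x, 1 ≤ η x
  graded : DirectSum.IsInternal (gradedPart b η)
  bracket_stable : ∀ m₁ m₂ : ℕ, ∀ x ∈ gradedPart b η m₁, ∀ y ∈ gradedPart b η m₂,
    D.bracket (x ⊗ₜ[k] y) ∈ gradedBelow b η (m₁ + m₂)
  pseudo_stable : ∀ m₁ m₂ : ℕ, ∀ x ∈ gradedPart b η m₁, ∀ y ∈ gradedPart b η m₂,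
    D.pseudo (x ⊗ₜ[k] y) ∈ tensorGradedBelow b η (m₁ + m₂)
  T_eq : D.T = D.S + D.pseudo
  bracket_T : D.bracket ∘ₗ D.T = -D.bracket
  pseudo_S : D.pseudo ∘ₗ D.S = -D.pseudo
  bracket_pseudo : D.bracket ∘ₗ D.pseudo = 0
  jacobi : ∀ t ∈ decreasing3 b,
    D.bracket ((idBr D.bracket ∘ₗ op12 D.S ∘ₗ op23 D.S
      - brId D.bracket ∘ₗ op23 D.S ∘ₗ op12 D.S
      + idBr D.bracket ∘ₗ op23 D.S ∘ₗ op12 D.S) t) = 0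

/-! ## Enveloping algebra and q-symmetric algebra -/

/-- The inclusion of `L ⊗ L` in the tensor algebra of `L`. -/
def tensorIncl : L ⊗[k] L →ₗ[k] TensorAlgebra k L :=
  LinearMap.mul' k (TensorAlgebra k L) ∘ₗ
    TensorProduct.map (TensorAlgebra.ι k) (TensorAlgebra.ι k)

/-- The relations `x ⊗ y = T (x ⊗ y) + [x, y]`, for basis elements `x`, `y`. -/
inductive EnvRel (b : Module.Basis ι k L) (D : Data k L) :
    TensorAlgebra k L → TensorAlgebra k L → Prop
  | mk (x y : ι) : EnvRel b D (tensorIncl (b x ⊗ₜ[k] b y))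
      (tensorIncl (D.T (b x ⊗ₜ[k] b y)) + TensorAlgebra.ι k (D.bracket (b x ⊗ₜ[k] b y)))

/-- The universal enveloping algebra. -/
abbrev UEnv (b : Module.Basis ι k L) (D : Data k L) : Type _ := RingQuot (EnvRel b D)

/-- The T-Lie structure `L⁰`: same presymmetry, zero bracket and pseudobracket. -/
def Data.degenerate (D : Data k L) : Data k L where
  S := D.S
  T := D.S
  pseudo := 0
  bracket := 0

/-- The q-symmetric algebra of `L`, that is `U(L⁰)`. -/
abbrev SymAlg (b : Module.Basis ι k L) (D : Data k L) : Type _ := UEnv b D.degenerate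

/-- `z_x`, the image of the basis element `x` in the q-symmetric algebra. -/
def z (b : Module.Basis ι k L) (D : Data k L) (x : ι) : SymAlg b D :=
  RingQuot.mkAlgHom k (EnvRel b D.degenerate) (TensorAlgebra.ι k (b x))

/-- `z_Σ = z_{x₁} ⋯ z_{xᵤ}` for `Σ = (x₁, …, xᵤ)`; `z_∅ = 1`. -/
def zMon (b : Module.Basis ι k L) (D : Data k L) (l : List ι) : SymAlg b D :=
  (l.map (z b D)).prod

/-- `η(Σ)`. -/
def degree (η : ι → ℕ) (l : List ι) : ℕ := (l.map η).sum

/-- `Σ` is a non-decreasing sequence. -/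
def NonDecreasing [LinearOrder ι] (l : List ι) : Prop := l.Pairwise (· ≤ ·)

/-- `x ≤ Σ`: `x` is at most the first term of `Σ` (no condition if `Σ` is empty). -/
def LeSeq [LinearOrder ι] (x : ι) (l : List ι) : Prop := ∀ y ∈ l.head?, x ≤ y

/-- `P_p`, spanned by the `z_Σ` with `Σ` non-decreasing and `η(Σ) ≤ p`. -/
def filtP [LinearOrder ι] (b : Module.Basis ι k L) (D : Data k L) (η : ι → ℕ) (p : ℕ) :
    Submodule k (SymAlg b D) :=
  Submodule.span k {v | ∃ l : List ι, NonDecreasing l ∧ degree η l ≤ p ∧ v = zMon b D l}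

/-! ## Adequacy -/

/-- `q_{x,y}`: the coefficient of `y ⊗ x` in `S (x ⊗ y)`. -/
def qCoeff (b : Module.Basis ι k L) (D : Data k L) (x y : ι) : k :=
  (b.tensorProduct b).repr (D.S (b x ⊗ₜ[k] b y)) (y, x)

/-- The map `L ⊗ L ⊗ P → P`, `(x ⊗ y) · v = x · (y · v)`, attached to a `k`-bilinear map
`L × P → P`, `(x, v) ↦ x · v`. -/
def act2 {P : Type*} [AddCommGroup P] [Module k P] (act : L →ₗ[k] Module.End k P) :
    L ⊗[k] L →ₗ[k] Module.End k P :=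
  LinearMap.mul' k (Module.End k P) ∘ₗ TensorProduct.map act act

/-- Conditions (A) and (B) on a `k`-bilinear map `L × P → P`, with `P` the q-symmetric algebra:
(A) `x · z_Σ = z_x z_Σ` for `x ≤ Σ`; (B) `x · z_Σ - z_x z_Σ ∈ P_{η(x) + η(Σ) - 1}`. -/
structure IsABMorphism [LinearOrder ι] (b : Module.Basis ι k L) (D : Data k L) (η : ι → ℕ)
    (act : L →ₗ[k] Module.End k (SymAlg b D)) : Prop where
  A : ∀ (x : ι) (l : List ι), NonDecreasing l → LeSeq x l →
    act (b x) (zMon b D l) = z b D x * zMon b D l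
  B : ∀ (x : ι) (l : List ι), NonDecreasing l →
    act (b x) (zMon b D l) - z b D x * zMon b D l ∈ filtP b D η (η x + degree η l - 1)

/-- The recursive rule that, with (A), constructs the morphism: for `x > y` and `y ≤ N`,
`x · z_{(y, N)} = q_{xy} z_y z_x z_N + q_{xy} y · (x · z_N - z_x z_N) + ⟨x, y⟩ · z_N
+ [x, y] · z_N`. -/
def IsRecursive [LinearOrder ι] (b : Module.Basis ι k L) (D : Data k L)
    (act : L →ₗ[k] Module.End k (SymAlg b D)) : Prop :=
  ∀ (x y : ι) (N : List ι), NonDecreasing (y :: N) → y < x →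
    act (b x) (zMon b D (y :: N)) =
      qCoeff b D x y • (z b D y * z b D x * zMon b D N)
      + qCoeff b D x y • act (b y) (act (b x) (zMon b D N) - z b D x * zMon b D N)
      + act2 act (D.pseudo (b x ⊗ₜ[k] b y)) (zMon b D N)
      + act (D.bracket (b x ⊗ₜ[k] b y)) (zMon b D N)

/-- `x · y · z_M - T (x ⊗ y) · z_M = [x, y] · z_M` whenever `η(x) + η(y) + η(M) ≤ r`. -/
def RepUpTo [LinearOrder ι] (b : Module.Basis ι k L) (D : Data k L) (η : ι → ℕ)
    (act : L →ₗ[k] Module.End k (SymAlg b D)) (r : ℕ) : Prop :=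
  ∀ (x y : ι) (M : List ι), NonDecreasing M → η x + η y + degree η M ≤ r →
    act (b x) (act (b y) (zMon b D M)) - act2 act (D.T (b x ⊗ₜ[k] b y)) (zMon b D M)
      = act (D.bracket (b x ⊗ₜ[k] b y)) (zMon b D M)

/-- The identity required of basis elements `x`, `y`, `w` (for `x > y > w`) acting on `v`. -/
def AdequacyIdentity (b : Module.Basis ι k L) (D : Data k L)
    (act : L →ₗ[k] Module.End k (SymAlg b D)) (x y w : ι) (v : SymAlg b D) : Prop :=
  act2 act (D.pseudo (b x ⊗ₜ[k] b y)) (act (b w) v)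
      - qCoeff b D x y • act (D.bracket (b y ⊗ₜ[k] D.bracket (b x ⊗ₜ[k] b w))) v =
    (qCoeff b D y w * qCoeff b D x w) •
        act2 act (D.pseudo (b w ⊗ₜ[k] D.bracket (b x ⊗ₜ[k] b y))) v
      + (qCoeff b D y w * qCoeff b D x w) •
        act (b w) (act2 act (D.pseudo (b x ⊗ₜ[k] b y)) v)
      + qCoeff b D y w • act2 act (D.pseudo (b x ⊗ₜ[k] b w)) (act (b y) v)
      - qCoeff b D x y • act (b y) (act2 act (D.pseudo (b x ⊗ₜ[k] b w)) v)
      + qCoeff b D y w • act (D.bracket (b x ⊗ₜ[k] b w)) (act (b y) v)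
      - qCoeff b D x y • act (b y) (act (D.bracket (b x ⊗ₜ[k] b w)) v)
      + act (b x) (act2 act (D.pseudo (b y ⊗ₜ[k] b w)) v)
      - (qCoeff b D x y * qCoeff b D x w) •
        act2 act (D.pseudo (b y ⊗ₜ[k] b w)) (act (b x) v)
      - (qCoeff b D x w * qCoeff b D x y) •
        act2 act (D.pseudo (D.bracket (b y ⊗ₜ[k] b w) ⊗ₜ[k] b x)) v

/-- Adequacy: the recursively constructed morphism with (A) and (B) exists, and for it (indeed
for every morphism with (A) and (B)) the representation property up to degree `r` implies the
adequacy identity up to degree `r + 1`. -/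
structure IsAdequate [LinearOrder ι] (b : Module.Basis ι k L) (D : Data k L) (η : ι → ℕ) :
    Prop where
  exists_morphism : ∃ act : L →ₗ[k] Module.End k (SymAlg b D),
    IsABMorphism b D η act ∧ IsRecursive b D act
  identity : ∀ act : L →ₗ[k] Module.End k (SymAlg b D), IsABMorphism b D η act →
    ∀ r : ℕ, RepUpTo b D η act r →
      ∀ (x y w : ι) (N : List ι), y < x → w < y → NonDecreasing N → LeSeq w N →
        η x + η y + η w + degree η N ≤ r + 1 →
        AdequacyIdentity b D act x y w (zMon b D N)

end General

/-! ## The ring `K[q, q⁻¹]`, `q = exp t` -/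

section Ring

variable (K : Type*) [Field K] [CharZero K]

/-- `K[q, q⁻¹] ⊆ K⟦t⟧` with `q = exp t` and `q⁻¹ = exp (-t)`. -/
def QRing : Subalgebra K (PowerSeries K) :=
  Algebra.adjoin K {PowerSeries.exp K, PowerSeries.evalNegHom (PowerSeries.exp K)}

/-- `q = exp t` as a unit of `K[q, q⁻¹]`. -/
def qExp : (QRing K)ˣ where
  val := ⟨PowerSeries.exp K, Algebra.subset_adjoin (by simp)⟩
  inv := ⟨PowerSeries.evalNegHom (PowerSeries.exp K), Algebra.subset_adjoin (by simp)⟩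
  val_inv := Subtype.ext PowerSeries.exp_mul_exp_neg_eq_one
  inv_val := Subtype.ext ((mul_comm _ _).trans PowerSeries.exp_mul_exp_neg_eq_one)

end Ring

/-! ## The algebra `(sl_{n+1}^+)_q` -/

/-- The index pairs `1 ≤ i < j ≤ n + 1` of the basis elements `e_{ij}`. -/
@[ext]
structure Idx (n : ℕ) where
  i : ℕ
  j : ℕ
  one_le : 1 ≤ i
  lt : i < j
  le : j ≤ n + 1

/-- Diagram order: `e_{ab} < e_{uv}` iff `a + b < u + v`, or `a + b = u + v` and `b < v`. -/
instance (n : ℕ) : LinearOrder (Idx n) :=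
  LinearOrder.lift' (fun x : Idx n => toLex (x.i + x.j, x.j)) (by
    intro x y h
    have h' := congrArg ofLex h
    simp only [ofLex_toLex, Prod.mk.injEq] at h'
    ext <;> omega)

theorem Idx.lt_iff {n : ℕ} (x y : Idx n) :
    x < y ↔ x.i + x.j < y.i + y.j ∨ (x.i + x.j = y.i + y.j ∧ x.j < y.j) :=
  Prod.Lex.toLex_lt_toLex

section SlPlus

variable (n : ℕ) {k : Type*} [CommRing k]

/-- The free module with basis the `e_{ij}`, `1 ≤ i < j ≤ n + 1`. -/
abbrev SlPlus (k : Type*) [CommRing k] : Type _ := Idx n →₀ k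

/-- The basis of the `e_{ij}`. -/
def slBasis (k : Type*) [CommRing k] : Module.Basis (Idx n) k (SlPlus n k) :=
  Finsupp.basisSingleOne

/-- `e_{ab}` for `1 ≤ a < b ≤ n + 1` (and `0` for other `a`, `b`). -/
def e (k : Type*) [CommRing k] (a b : ℕ) : SlPlus n k :=
  if h : 1 ≤ a ∧ a < b ∧ b ≤ n + 1 then slBasis n k ⟨a, b, h.1, h.2.1, h.2.2⟩ else 0

variable {n}

/-- The matrix commutator `[e_{ij}, e_{uv}] = δ_{ju} e_{iv} - δ_{vi} e_{uj}`. -/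
def classicalBracket (k : Type*) [CommRing k] (x y : Idx n) : SlPlus n k :=
  (if x.j = y.i then e n k x.i y.j else 0) - (if y.j = x.i then e n k y.i x.j else 0)

/-- The integer `c` with `[h_x, e_y] = c e_y`, where `h_x = [e_x, e_xᵗ] = e_{ii} - e_{jj}` for
`x = (i, j)`. -/
def cartan (x y : Idx n) : ℤ :=
  (if x.i = y.i then 1 else 0) - (if x.j = y.i then 1 else 0)
    - (if x.i = y.j then 1 else 0) + (if x.j = y.j then 1 else 0)

/-- `q_{x,y}`: `q ^ c_{x,y}` if `x < y`; the values for `x > y` are forced by `S² = Id`, and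
`q_{x,x} = 1`. -/
def slQ (q : kˣ) (x y : Idx n) : k :=
  if x < y then ((q ^ cartan x y : kˣ) : k)
  else if y < x then ((q ^ (-cartan y x) : kˣ) : k)
  else 1

/-- `[x, y]_q`: the usual bracket if `x < y`; the values for `x > y` are forced by
antisymmetry, `[x, y]_q = - q_{x,y} [y, x]_q`, and `[x, x]_q = 0`. -/
def slBracketFun (q : kˣ) (x y : Idx n) : SlPlus n k :=
  if x < y then classicalBracket k x y
  else if y < x then -(slQ q x y • classicalBracket k y x)
  else 0

/-- The pseudobracket of basis elements `x = e_{ij}`, `y = e_{uv}`. -/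
def slPseudoFun (q : kˣ) (x y : Idx n) : SlPlus n k ⊗[k] SlPlus n k :=
  if x.i < y.i ∧ y.i < x.j ∧ x.j < y.j then
    ((q : k) - ((q⁻¹ : kˣ) : k)) • (e n k x.i y.j ⊗ₜ[k] e n k y.i x.j)
  else if y.i < x.i ∧ x.i < y.j ∧ y.j < x.j then
    (((q⁻¹ : kˣ) : k) - (q : k)) • (e n k y.i x.j ⊗ₜ[k] e n k x.i y.j)
  else 0

variable (n)

/-- The presymmetry, `S (x ⊗ y) = q_{x,y} y ⊗ x`. -/
def slS (q : kˣ) : SlPlus n k ⊗[k] SlPlus n k →ₗ[k] SlPlus n k ⊗[k] SlPlus n k :=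
  ((slBasis n k).tensorProduct (slBasis n k)).constr k
    fun p => slQ q p.1 p.2 • (slBasis n k p.2 ⊗ₜ[k] slBasis n k p.1)

/-- The pseudobracket. -/
def slPseudo (q : kˣ) : SlPlus n k ⊗[k] SlPlus n k →ₗ[k] SlPlus n k ⊗[k] SlPlus n k :=
  ((slBasis n k).tensorProduct (slBasis n k)).constr k fun p => slPseudoFun q p.1 p.2

/-- The bracket `[ , ]_q`. -/
def slBracket (q : kˣ) : SlPlus n k ⊗[k] SlPlus n k →ₗ[k] SlPlus n k :=
  ((slBasis n k).tensorProduct (slBasis n k)).constr k fun p => slBracketFun q p.1 p.2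

/-- The structure maps of `(sl_{n+1}^+)_q`, with `T = S + ⟨ , ⟩`. -/
def slData (q : kˣ) : Data k (SlPlus n k) where
  S := slS n q
  T := slS n q + slPseudo n q
  pseudo := slPseudo n q
  bracket := slBracket n q

/-- `η(e_{ij}) = i (j - i)`. -/
def slη (x : Idx n) : ℕ := x.i * (x.j - x.i)

end SlPlus

end TLie

end

/-!
The algebra `(sl_{n+1}^+)_q` is treated over an arbitrary commutative ring with an arbitrary unit
`q`: the scalar by which two distinct basis elements are exchanged is `q^{±1}` or `1`, and it
depends only on how the two index pairs share endpoints (`slQ_eq`). The basic `T`-Lie axioms are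
identities between structure constants, checked on the basis (`IsBasicTLieAlgebra.of_basis`).

For the existence half of adequacy, the ordered monomials form a basis of the `q`-symmetric algebra
(`zMon_linearIndependent`, by a faithful model on multisets, and `span_zMon`). Condition (R)
computes `x · z_Σ` from values of the action in smaller total degree, because the bracket and the
pseudobracket lower the degree. Starting from the zero map and passing repeatedly to the right-hand
sides of (A) and (R), one therefore obtains a sequence of maps of which the `d`-th satisfies (B),
and no longer changes, in total degree below `d`. Its stable values are the required map
(`exists_recursive_morphism`).

For the identity, let `λ > μ > γ`, and suppose that `x · y · z_M` can be exchanged to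
`q_{x,y} y · x · z_M` plus a correction term in degree at most `r`. Up to the Jacobi identity and
the compatibility of `S` with the bracket, the adequacy identity says that the two ways of
reversing `λ · μ · γ · z_N`, starting with the left or with the right pair, have the same
correction terms (`IsBasicTLieAlgebra.adequacyIdentity_of_overlap`). Every word in these correction
terms has degree at most `r`, for merging `(i, j)`, `(j, v)` to `(i, v)` strictly lowers the sum of
the `i (j - i)`, and so does crossing `(i, j)`, `(u, v)` with `i < u < j < v` to `(i, v)`, `(u, j)`;
both are cases of the rearrangement inequality. Hence the exchange relations apply to all of
them, and rewriting both sides to words with lexicographically decreasing index pairs gives the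
same result, for each relative position of the six endpoints (`overlap_resolvable`).
-/

noncomputable section

namespace TLie

/-! ### Ordered monomials in the q-symmetric algebra -/

section QSymmetric

variable {k L ι : Type*} [CommRing k] [AddCommGroup L] [Module k L]

/-- `S` acts on the basis by the scalars `q`, where `S² = Id` and `S` fixes every `x ⊗ x`. -/
structure IsQFlip (b : Module.Basis ι k L) (D : Data k L) (q : ι → ι → k) : Prop where
  S_basis : ∀ x y, D.S (b x ⊗ₜ[k] b y) = q x y • (b y ⊗ₜ[k] b x)
  mul_swap : ∀ x y, q x y * q y x = 1
  self : ∀ x, q x x = 1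

variable {b : Module.Basis ι k L} {D : Data k L} {q : ι → ι → k}

theorem qCoeff_eq (hS : ∀ x y, D.S (b x ⊗ₜ[k] b y) = q x y • (b y ⊗ₜ[k] b x)) (x y : ι) :
    qCoeff b D x y = q x y := by
  rw [qCoeff, hS, map_smul, ← Module.Basis.tensorProduct_apply, Finsupp.smul_apply,
    Module.Basis.repr_self, Finsupp.single_eq_same, smul_eq_mul, mul_one]

theorem tensorIncl_tmul (u v : L) :
    tensorIncl (u ⊗ₜ[k] v) = TensorAlgebra.ι k u * TensorAlgebra.ι k v := by
  simp [tensorIncl]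

theorem act2_tmul {P : Type*} [AddCommGroup P] [Module k P] (act : L →ₗ[k] Module.End k P)
    (u v : L) (w : P) : act2 act (u ⊗ₜ[k] v) w = act u (act v w) := by
  simp [act2]

theorem z_mul_z (h : IsQFlip b D q) (x y : ι) :
    z b D x * z b D y = q x y • (z b D y * z b D x) := by
  have := RingQuot.mkAlgHom_rel k (EnvRel.mk (b := b) (D := D.degenerate) x y)
  have hT : tensorIncl (D.degenerate.T (b x ⊗ₜ[k] b y)) =
      q x y • (TensorAlgebra.ι k (b y) * TensorAlgebra.ι k (b x)) := by
    simp [Data.degenerate, h.S_basis, tensorIncl_tmul]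
  have hB : TensorAlgebra.ι k (D.degenerate.bracket (b x ⊗ₜ[k] b y)) = 0 := by
    simp [Data.degenerate]
  rw [hT, hB, add_zero, tensorIncl_tmul, map_mul, map_smul, map_mul] at this
  exact this

theorem z_mul_z_mul (h : IsQFlip b D q) (x y : ι) (v : SymAlg b D) :
    z b D x * (z b D y * v) = q x y • (z b D y * (z b D x * v)) := by
  rw [← mul_assoc, z_mul_z h, smul_mul_assoc, mul_assoc]

@[simp] theorem zMon_nil : zMon b D [] = 1 := rfl

@[simp] theorem zMon_cons (x : ι) (l : List ι) :
    zMon b D (x :: l) = z b D x * zMon b D l := by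
  simp [zMon]

@[simp] theorem degree_nil (η : ι → ℕ) : degree η [] = 0 := rfl

@[simp] theorem degree_cons (η : ι → ℕ) (x : ι) (l : List ι) :
    degree η (x :: l) = η x + degree η l := by
  simp [degree]

variable [LinearOrder ι]

/-- The scalar picked up by `z_x` on its way to its place in the ordered monomial `z_M`. -/
def moveCoeff (q : ι → ι → k) (x : ι) (M : Multiset ι) : k :=
  ((M.filter (· < x)).map (q x)).prod

theorem moveCoeff_cons_of_lt {x y : ι} (h : y < x) (M : Multiset ι) :
    moveCoeff q x (y ::ₘ M) = q x y * moveCoeff q x M := by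
  simp [moveCoeff, Multiset.filter_cons_of_pos (p := (· < x)) _ h]

theorem moveCoeff_cons_of_le {x y : ι} (h : x ≤ y) (M : Multiset ι) :
    moveCoeff q x (y ::ₘ M) = moveCoeff q x M := by
  simp [moveCoeff, Multiset.filter_cons_of_neg (p := (· < x)) _ (not_lt.mpr h)]

/-- Multiplication by `z_x` on the free module on the multisets, which model the ordered
monomials. -/
def modelMul (q : ι → ι → k) (x : ι) : Module.End k (Multiset ι →₀ k) :=
  Finsupp.linearCombination k fun M => Finsupp.single (x ::ₘ M) (moveCoeff q x M)

theorem modelMul_single (x : ι) (M : Multiset ι) (c : k) :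
    modelMul q x (Finsupp.single M c) = Finsupp.single (x ::ₘ M) (c * moveCoeff q x M) := by
  simp [modelMul]

/-- The operators of the model satisfy the defining relations of the q-symmetric algebra. -/
theorem modelMul_comm (h : IsQFlip b D q) (x y : ι) :
    modelMul q x * modelMul q y = q x y • (modelMul q y * modelMul q x) := by
  refine Finsupp.lhom_ext fun M c => ?_
  simp only [Module.End.mul_apply, modelMul_single, LinearMap.smul_apply, Finsupp.smul_single,
    smul_eq_mul]
  rw [Multiset.cons_swap]
  congr 1
  rcases lt_trichotomy x y with hxy | rfl | hxy
  · rw [moveCoeff_cons_of_le hxy.le, moveCoeff_cons_of_lt hxy]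
    linear_combination (-c * moveCoeff q x M * moveCoeff q y M) * h.mul_swap x y
  · rw [h.self]; ring
  · rw [moveCoeff_cons_of_le hxy.le, moveCoeff_cons_of_lt hxy]
    ring

/-- The representation of the q-symmetric algebra on the model. -/
def modelRep (h : IsQFlip b D q) : SymAlg b D →ₐ[k] Module.End k (Multiset ι →₀ k) :=
  RingQuot.liftAlgHom k ⟨TensorAlgebra.lift k (b.constr k (modelMul q)), by
    rintro _ _ ⟨x, y⟩
    simp [Data.degenerate, h.S_basis, tensorIncl_tmul, Module.Basis.constr_basis,
      modelMul_comm h x y]⟩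

theorem modelRep_z (h : IsQFlip b D q) (x : ι) : modelRep h (z b D x) = modelMul q x := by
  simp [modelRep, z, Module.Basis.constr_basis]

theorem modelRep_zMon (h : IsQFlip b D q) {l : List ι} (hl : NonDecreasing l) :
    modelRep h (zMon b D l) (Finsupp.single 0 1) = Finsupp.single (l : Multiset ι) 1 := by
  induction l with
  | nil => simp
  | cons x l ih =>
    have hl' := List.pairwise_cons.mp hl
    have hx : moveCoeff q x (l : Multiset ι) = 1 := by
      rw [moveCoeff, Multiset.filter_eq_nil.mpr]
      · simp
      · intro y hy
        exact not_lt.mpr (hl'.1 y (by simpa using hy))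
    rw [zMon_cons, map_mul, Module.End.mul_apply, ih hl'.2, modelRep_z, modelMul_single, hx]
    simp

theorem zMon_linearIndependent (h : IsQFlip b D q) :
    LinearIndependent k fun l : {l : List ι // NonDecreasing l} => zMon b D l.1 := by
  refine LinearIndependent.of_comp
    ((LinearMap.applyₗ (Finsupp.single 0 1)) ∘ₗ (modelRep h).toLinearMap) ?_
  have : (fun l : {l : List ι // NonDecreasing l} =>
      (Finsupp.single (l.1 : Multiset ι) (1 : k))) =
      Finsupp.basisSingleOne ∘ fun l : {l : List ι // NonDecreasing l} =>
        (l.1 : Multiset ι) := by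
    ext1 l; simp
  have hind : LinearIndependent k fun l : {l : List ι // NonDecreasing l} =>
      (Finsupp.single (l.1 : Multiset ι) (1 : k)) := by
    rw [this]
    refine Finsupp.basisSingleOne.linearIndependent.comp _ ?_
    intro l l' hll
    exact Subtype.ext ((Multiset.coe_eq_coe.mp hll).eq_of_pairwise' l.2 l'.2)
  convert hind using 1
  ext1 l
  simpa using modelRep_zMon h l.2

/-- Sorting: `z_x z_Σ` is a multiple of the ordered monomial with `x` inserted. -/
theorem z_mul_zMon (h : IsQFlip b D q) (x : ι) {l : List ι} (hl : NonDecreasing l) :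
    ∃ c : k, z b D x * zMon b D l = c • zMon b D (l.orderedInsert (· ≤ ·) x) := by
  induction l with
  | nil => exact ⟨1, by simp⟩
  | cons y l ih =>
    by_cases hxy : x ≤ y
    · exact ⟨1, by simp [hxy]⟩
    · obtain ⟨c, hc⟩ := ih (List.pairwise_cons.mp hl).2
      refine ⟨q x y * c, ?_⟩
      rw [zMon_cons, z_mul_z_mul h, hc, List.orderedInsert_of_not_le _ _ hxy, zMon_cons,
        mul_smul_comm, smul_smul]

theorem nonDecreasing_orderedInsert (x : ι) {l : List ι} (hl : NonDecreasing l) :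
    NonDecreasing (l.orderedInsert (· ≤ ·) x) :=
  List.Pairwise.orderedInsert x l hl

theorem degree_orderedInsert (η : ι → ℕ) (x : ι) (l : List ι) :
    degree η (l.orderedInsert (· ≤ ·) x) = η x + degree η l := by
  rw [← degree_cons]
  exact ((List.perm_orderedInsert _ x l).map η).sum_eq

theorem zMon_mem_filtP (η : ι → ℕ) {l : List ι} (hl : NonDecreasing l) {p : ℕ}
    (hp : degree η l ≤ p) : zMon b D l ∈ filtP b D η p :=
  Submodule.subset_span ⟨l, hl, hp, rfl⟩

theorem filtP_mono (η : ι → ℕ) {p p' : ℕ} (h : p ≤ p') : filtP b D η p ≤ filtP b D η p' :=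
  Submodule.span_mono fun _ ⟨l, hl, hp, hv⟩ => ⟨l, hl, hp.trans h, hv⟩

theorem z_mul_mem_filtP (h : IsQFlip b D q) (η : ι → ℕ) (x : ι) {p : ℕ} {v : SymAlg b D}
    (hv : v ∈ filtP b D η p) : z b D x * v ∈ filtP b D η (η x + p) := by
  have : filtP b D η p ≤ (filtP b D η (η x + p)).comap (LinearMap.mulLeft k (z b D x)) := by
    refine Submodule.span_le.mpr ?_
    rintro _ ⟨l, hl, hp, rfl⟩
    obtain ⟨c, hc⟩ := z_mul_zMon h x hl
    simp only [Submodule.comap_coe, Set.mem_preimage, LinearMap.mulLeft_apply, SetLike.mem_coe, hc]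
    refine Submodule.smul_mem _ _ (zMon_mem_filtP η (nonDecreasing_orderedInsert x hl) ?_)
    rw [degree_orderedInsert]
    omega
  exact this hv

theorem span_zMon (h : IsQFlip b D q) :
    ⊤ ≤ Submodule.span k
      (Set.range fun l : {l : List ι // NonDecreasing l} => zMon b D l.1) := by
  set W := Submodule.span k
    (Set.range fun l : {l : List ι // NonDecreasing l} => zMon b D l.1) with hW
  have hz : ∀ (x : ι), ∀ w ∈ W, z b D x * w ∈ W := by
    intro x
    have : W ≤ W.comap (LinearMap.mulLeft k (z b D x)) := by
      rw [hW, Submodule.span_le]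
      rintro _ ⟨l, rfl⟩
      obtain ⟨c, hc⟩ := z_mul_zMon h x l.2
      simp only [Submodule.comap_coe, Set.mem_preimage, LinearMap.mulLeft_apply,
        SetLike.mem_coe, hc]
      exact Submodule.smul_mem _ _
        (Submodule.subset_span ⟨⟨_, nonDecreasing_orderedInsert x l.2⟩, rfl⟩)
    exact fun w hw => this hw
  have hmul : ∀ a : TensorAlgebra k L, ∀ w ∈ W,
      RingQuot.mkAlgHom k (EnvRel b D.degenerate) a * w ∈ W := by
    intro a
    induction a using TensorAlgebra.induction with
    | algebraMap r =>
      intro w hw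
      rw [AlgHom.commutes, ← Algebra.smul_def]
      exact W.smul_mem _ hw
    | ι u =>
      intro w hw
      rw [← b.linearCombination_repr u, Finsupp.linearCombination_apply, Finsupp.sum, map_sum,
        map_sum, Finset.sum_mul]
      refine W.sum_mem fun x _ => ?_
      rw [map_smul, map_smul, smul_mul_assoc]
      exact W.smul_mem _ (hz x w hw)
    | mul a a' ha ha' =>
      intro w hw
      rw [map_mul, mul_assoc]
      exact ha _ (ha' w hw)
    | add a a' ha ha' =>
      intro w hw
      rw [map_add, add_mul]
      exact W.add_mem (ha w hw) (ha' w hw)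
  intro v _
  obtain ⟨a, rfl⟩ := RingQuot.mkAlgHom_surjective k (EnvRel b D.degenerate) v
  have h1 : (1 : SymAlg b D) ∈ W := Submodule.subset_span ⟨⟨[], List.Pairwise.nil⟩, rfl⟩
  simpa using hmul a 1 h1

/-- The ordered monomials form a basis of the q-symmetric algebra. -/
def zBasis (h : IsQFlip b D q) :
    Module.Basis {l : List ι // NonDecreasing l} k (SymAlg b D) :=
  Module.Basis.mk (zMon_linearIndependent h) (span_zMon h)

theorem zBasis_apply (h : IsQFlip b D q) (l : {l : List ι // NonDecreasing l}) :
    zBasis h l = zMon b D l.1 := by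
  simp [zBasis]

end QSymmetric

/-! ### Morphisms with (A) and (B), and their behaviour on the filtration -/

section Filtration

variable {k L ι : Type*} [CommRing k] [AddCommGroup L] [Module k L]
variable {b : Module.Basis ι k L} {D : Data k L} {q : ι → ι → k} {η : ι → ℕ}

theorem gradedBelow_le {s : ℕ} {W : Submodule k L} (h : ∀ x, η x + 1 ≤ s → b x ∈ W) :
    gradedBelow b η s ≤ W := by
  refine iSup_le fun m => Submodule.span_le.mpr ?_
  rintro _ ⟨x, hx, rfl⟩
  exact h x (by rw [show η x = m from hx]; exact m.2)

theorem tensorGradedBelow_le {s : ℕ} {W : Submodule k (L ⊗[k] L)}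
    (h : ∀ x y, η x + η y + 1 ≤ s → b x ⊗ₜ[k] b y ∈ W) : tensorGradedBelow b η s ≤ W := by
  refine iSup_le fun m => ?_
  rw [gradedPart, gradedPart, Submodule.map₂_span_span, Submodule.span_le]
  rintro _ ⟨_, ⟨x, hx, rfl⟩, _, ⟨y, hy, rfl⟩, rfl⟩
  exact h x y (by rw [show η x = m.1.1 from hx, show η y = m.1.2 from hy]; exact m.2)

theorem basis_mem_gradedPart (x : ι) : b x ∈ gradedPart b η (η x) :=
  Submodule.subset_span ⟨x, rfl, rfl⟩

theorem basis_mem_gradedBelow {x : ι} {s : ℕ} (h : η x + 1 ≤ s) : b x ∈ gradedBelow b η s :=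
  Submodule.mem_iSup_of_mem ⟨η x, h⟩ (basis_mem_gradedPart x)

theorem tmul_mem_tensorGradedBelow {x y : ι} {s : ℕ} (h : η x + η y + 1 ≤ s) :
    b x ⊗ₜ[k] b y ∈ tensorGradedBelow b η s :=
  Submodule.mem_iSup_of_mem ⟨(η x, η y), h⟩
    (Submodule.apply_mem_map₂ _ (basis_mem_gradedPart x) (basis_mem_gradedPart y))

variable [LinearOrder ι]

theorem filtP_le {p : ℕ} {W : Submodule k (SymAlg b D)}
    (h : ∀ l, NonDecreasing l → degree η l ≤ p → zMon b D l ∈ W) : filtP b D η p ≤ W := by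
  refine Submodule.span_le.mpr ?_
  rintro _ ⟨l, hl, hp, rfl⟩
  exact h l hl hp

/-- In total degree below `n`, the operator of `x` is multiplication by `z_x` up to terms of
lower degree. -/
def CloseBelow (b : Module.Basis ι k L) (D : Data k L) (η : ι → ℕ)
    (F : L →ₗ[k] Module.End k (SymAlg b D)) (n : ℕ) : Prop :=
  ∀ x p, ∀ v ∈ filtP b D η p, η x + p < n →
    F (b x) v - z b D x * v ∈ filtP b D η (η x + p - 1)

/-- The two maps agree in total degree below `n`. -/
def AgreeBelow (b : Module.Basis ι k L) (D : Data k L) (η : ι → ℕ)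
    (F G : L →ₗ[k] Module.End k (SymAlg b D)) (n : ℕ) : Prop :=
  ∀ x p, ∀ v ∈ filtP b D η p, η x + p < n → F (b x) v = G (b x) v

variable {F G : L →ₗ[k] Module.End k (SymAlg b D)} {n : ℕ}

theorem closeBelow_of_zMon
    (h : ∀ x l, NonDecreasing l → η x + degree η l < n →
      F (b x) (zMon b D l) - z b D x * zMon b D l ∈ filtP b D η (η x + degree η l - 1)) :
    CloseBelow b D η F n := by
  intro x p v hv hn
  have : filtP b D η p ≤
      (filtP b D η (η x + p - 1)).comap (F (b x) - LinearMap.mulLeft k (z b D x)) :=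
    filtP_le fun l hl hp => filtP_mono η (by omega) (h x l hl (by omega))
  exact this hv

theorem agreeBelow_of_zMon
    (h : ∀ x l, NonDecreasing l → η x + degree η l < n →
      F (b x) (zMon b D l) = G (b x) (zMon b D l)) :
    AgreeBelow b D η F G n := by
  intro x p v hv hn
  have : filtP b D η p ≤ LinearMap.eqLocus (F (b x)) (G (b x)) :=
    filtP_le fun l hl hp => h x l hl (by omega)
  exact this hv

namespace CloseBelow

theorem mem (hq : IsQFlip b D q) (hF : CloseBelow b D η F n) {x : ι} {p : ℕ}
    {v : SymAlg b D} (hv : v ∈ filtP b D η p) (hn : η x + p < n) :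
    F (b x) v ∈ filtP b D η (η x + p) := by
  rw [← sub_add_cancel (F (b x) v) (z b D x * v)]
  exact Submodule.add_mem _ (filtP_mono η (Nat.sub_le _ _) (hF x p v hv hn))
    (z_mul_mem_filtP hq η x hv)

theorem mem_of_gradedBelow (hq : IsQFlip b D q) (hF : CloseBelow b D η F n) {s p : ℕ} {u : L}
    {v : SymAlg b D} (hu : u ∈ gradedBelow b η s) (hv : v ∈ filtP b D η p) (hn : s + p ≤ n) :
    F u v ∈ filtP b D η (s + p - 1) := by
  have : gradedBelow b η s ≤ (filtP b D η (s + p - 1)).comap (F.flip v) :=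
    gradedBelow_le fun x hx => filtP_mono η (by omega) (hF.mem hq hv (by omega))
  exact this hu

theorem mem_of_tensorGradedBelow (hq : IsQFlip b D q) (hF : CloseBelow b D η F n) {s p : ℕ}
    {t : L ⊗[k] L} {v : SymAlg b D} (ht : t ∈ tensorGradedBelow b η s)
    (hv : v ∈ filtP b D η p) (hn : s + p ≤ n) :
    act2 F t v ∈ filtP b D η (s + p - 1) := by
  have : tensorGradedBelow b η s ≤ (filtP b D η (s + p - 1)).comap ((act2 F).flip v) := by
    refine tensorGradedBelow_le fun x y hxy => ?_
    rw [Submodule.mem_comap, LinearMap.flip_apply, act2_tmul]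
    exact filtP_mono η (by omega) (hF.mem hq (hF.mem hq hv (by omega)) (by omega))
  exact this ht

end CloseBelow

namespace AgreeBelow

theorem of_gradedBelow (hFG : AgreeBelow b D η F G n) {s p : ℕ} {u : L} {v : SymAlg b D}
    (hu : u ∈ gradedBelow b η s) (hv : v ∈ filtP b D η p) (hn : s + p ≤ n) :
    F u v = G u v := by
  have : gradedBelow b η s ≤ LinearMap.eqLocus (F.flip v) (G.flip v) :=
    gradedBelow_le fun x hx => hFG x p v hv (by omega)
  exact this hu

theorem of_tensorGradedBelow (hq : IsQFlip b D q) (hF : CloseBelow b D η F n)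
    (hFG : AgreeBelow b D η F G n) {s p : ℕ} {t : L ⊗[k] L} {v : SymAlg b D}
    (ht : t ∈ tensorGradedBelow b η s) (hv : v ∈ filtP b D η p) (hn : s + p ≤ n) :
    act2 F t v = act2 G t v := by
  have : tensorGradedBelow b η s ≤ LinearMap.eqLocus ((act2 F).flip v) ((act2 G).flip v) := by
    refine tensorGradedBelow_le fun x y hxy => ?_
    rw [LinearMap.mem_eqLocus, LinearMap.flip_apply, LinearMap.flip_apply, act2_tmul, act2_tmul,
      ← hFG y p v hv (by omega)]
    exact hFG x (η y + p) _ (hF.mem hq hv (by omega)) (by omega)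
  exact this ht

theorem trans {H : L →ₗ[k] Module.End k (SymAlg b D)} (hFG : AgreeBelow b D η F G n)
    (hGH : AgreeBelow b D η G H n) : AgreeBelow b D η F H n :=
  fun x p v hv hn => (hFG x p v hv hn).trans (hGH x p v hv hn)

theorem mono (hFG : AgreeBelow b D η F G n) {m : ℕ} (h : m ≤ n) : AgreeBelow b D η F G m :=
  fun x p v hv hm => hFG x p v hv (hm.trans_le h)

end AgreeBelow

/-- A morphism with (A) and (B) is multiplication up to lower degree in all degrees. -/
theorem IsABMorphism.closeBelow {act : L →ₗ[k] Module.End k (SymAlg b D)}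
    (h : IsABMorphism b D η act) (n : ℕ) : CloseBelow b D η act n :=
  closeBelow_of_zMon fun x l hl _ => h.B x l hl

end Filtration

/-! ### Construction of the recursive morphism -/

section Recursion

variable {k L ι : Type*} [CommRing k] [AddCommGroup L] [Module k L] [LinearOrder ι]
variable {b : Module.Basis ι k L} {D : Data k L} {q : ι → ι → k} {η : ι → ℕ}

/-- The degree conditions on the bracket and the pseudobracket, on the basis. -/
structure LowersDegree (b : Module.Basis ι k L) (D : Data k L) (η : ι → ℕ) : Prop where
  pos : ∀ x, 1 ≤ η x
  bracket : ∀ x y, D.bracket (b x ⊗ₜ[k] b y) ∈ gradedBelow b η (η x + η y)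
  pseudo : ∀ x y, D.pseudo (b x ⊗ₜ[k] b y) ∈ tensorGradedBelow b η (η x + η y)

/-- The right-hand side of (A) or of (R), with `F` in the place of the morphism. -/
def stepVal (b : Module.Basis ι k L) (D : Data k L)
    (F : L →ₗ[k] Module.End k (SymAlg b D)) (x : ι) : List ι → SymAlg b D
  | [] => z b D x
  | y :: N =>
    if x ≤ y then z b D x * zMon b D (y :: N)
    else qCoeff b D x y • (z b D y * z b D x * zMon b D N)
      + qCoeff b D x y • F (b y) (F (b x) (zMon b D N) - z b D x * zMon b D N)
      + act2 F (D.pseudo (b x ⊗ₜ[k] b y)) (zMon b D N)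
      + F (D.bracket (b x ⊗ₜ[k] b y)) (zMon b D N)

/-- The map whose value at `x ⊗ z_Σ` is `f x Σ`. -/
def ofValues (h : IsQFlip b D q) (f : ι → List ι → SymAlg b D) :
    L →ₗ[k] Module.End k (SymAlg b D) :=
  b.constr k fun x => (zBasis h).constr k fun l => f x l.1

theorem ofValues_apply (h : IsQFlip b D q) (f : ι → List ι → SymAlg b D) (x : ι) {l : List ι}
    (hl : NonDecreasing l) : ofValues h f (b x) (zMon b D l) = f x l := by
  rw [ofValues, Module.Basis.constr_basis, ← zBasis_apply h ⟨l, hl⟩, Module.Basis.constr_basis]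

/-- Successive approximations to the recursive morphism: the `n`-th is right in total degree
below `n`. -/
def approx (h : IsQFlip b D q) : ℕ → L →ₗ[k] Module.End k (SymAlg b D)
  | 0 => 0
  | n + 1 => ofValues h (stepVal b D (approx h n))

variable {F G : L →ₗ[k] Module.End k (SymAlg b D)} {n : ℕ}

theorem stepVal_close (h : IsQFlip b D q) (hη : LowersDegree b D η)
    (hF : CloseBelow b D η F n) (x : ι) {l : List ι} (hl : NonDecreasing l)
    (hn : η x + degree η l < n + 1) :
    stepVal b D F x l - z b D x * zMon b D l ∈ filtP b D η (η x + degree η l - 1) := by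
  cases l with
  | nil => simp [stepVal]
  | cons y N =>
    rw [stepVal]
    split_ifs with hxy
    · simp
    · have hx := hη.pos x
      have hy := hη.pos y
      rw [degree_cons] at hn ⊢
      have hN : zMon b D N ∈ filtP b D η (degree η N) :=
        zMon_mem_filtP η (List.pairwise_cons.mp hl).2 le_rfl
      rw [zMon_cons, z_mul_z_mul h x y, qCoeff_eq h.S_basis, mul_assoc, add_assoc, add_assoc,
        add_sub_cancel_left]
      refine Submodule.add_mem _ (Submodule.smul_mem _ _ ?_) (Submodule.add_mem _ ?_ ?_)
      · exact filtP_mono η (by omega) (hF.mem h (hF x _ _ hN (by omega)) (by omega))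
      · exact filtP_mono η (by omega) (hF.mem_of_tensorGradedBelow h (hη.pseudo x y) hN (by omega))
      · exact filtP_mono η (by omega) (hF.mem_of_gradedBelow h (hη.bracket x y) hN (by omega))

theorem stepVal_agree (h : IsQFlip b D q) (hη : LowersDegree b D η)
    (hF : CloseBelow b D η F n) (hFG : AgreeBelow b D η F G n) (x : ι) {l : List ι}
    (hl : NonDecreasing l) (hn : η x + degree η l < n + 1) :
    stepVal b D F x l = stepVal b D G x l := by
  cases l with
  | nil => rfl
  | cons y N =>
    rw [stepVal, stepVal]
    split_ifs with hxy
    · rfl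
    · have hx := hη.pos x
      have hy := hη.pos y
      rw [degree_cons] at hn
      have hN : zMon b D N ∈ filtP b D η (degree η N) :=
        zMon_mem_filtP η (List.pairwise_cons.mp hl).2 le_rfl
      rw [hFG.of_tensorGradedBelow h hF (hη.pseudo x y) hN (by omega),
        hFG.of_gradedBelow (hη.bracket x y) hN (by omega),
        hFG y _ _ (hF x _ _ hN (by omega)) (by omega), hFG x _ _ hN (by omega)]

theorem approx_close_agree (h : IsQFlip b D q) (hη : LowersDegree b D η) (n : ℕ) :
    CloseBelow b D η (approx h n) n ∧ AgreeBelow b D η (approx h n) (approx h (n + 1)) n := by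
  induction n with
  | zero => exact ⟨fun _ _ _ _ hn => absurd hn (by omega), fun _ _ _ _ hn => absurd hn (by omega)⟩
  | succ n ih =>
    refine ⟨closeBelow_of_zMon fun x l hl hn => ?_, agreeBelow_of_zMon fun x l hl hn => ?_⟩
    · rw [approx, ofValues_apply h _ x hl]
      exact stepVal_close h hη ih.1 x hl hn
    · rw [approx, approx, ofValues_apply h _ x hl, ofValues_apply h _ x hl]
      exact stepVal_agree h hη ih.1 ih.2 x hl hn

theorem approx_agree (h : IsQFlip b D q) (hη : LowersDegree b D η) {m n : ℕ} (hmn : m ≤ n) :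
    AgreeBelow b D η (approx h m) (approx h n) m := by
  induction n, hmn using Nat.le_induction with
  | base => exact fun _ _ _ _ _ => rfl
  | succ n hmn ih => exact ih.trans ((approx_close_agree h hη n).2.mono hmn)

/-- The recursive morphism: in each degree, an approximation that is right there. -/
def recMorphism (h : IsQFlip b D q) (η : ι → ℕ) : L →ₗ[k] Module.End k (SymAlg b D) :=
  ofValues h fun x l => approx h (η x + degree η l + 1) (b x) (zMon b D l)

theorem approx_agree_recMorphism (h : IsQFlip b D q) (hη : LowersDegree b D η) (n : ℕ) :
    AgreeBelow b D η (approx h n) (recMorphism h η) n := by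
  refine agreeBelow_of_zMon fun x l hl hn => ?_
  rw [recMorphism, ofValues_apply h _ x hl]
  exact (approx_agree h hη (by omega : η x + degree η l + 1 ≤ n) x _ _
    (zMon_mem_filtP η hl le_rfl) (by omega)).symm

/-- The recursive morphism is a fixed point of the recursion. -/
theorem recMorphism_eq_stepVal (h : IsQFlip b D q) (hη : LowersDegree b D η) (x : ι)
    {l : List ι} (hl : NonDecreasing l) :
    recMorphism h η (b x) (zMon b D l) = stepVal b D (recMorphism h η) x l := by
  rw [recMorphism, ofValues_apply h _ x hl, approx, ofValues_apply h _ x hl]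
  exact stepVal_agree h hη (approx_close_agree h hη _).1 (approx_agree_recMorphism h hη _) x hl
    (by omega)

theorem exists_recursive_morphism (h : IsQFlip b D q) (hη : LowersDegree b D η) :
    ∃ act : L →ₗ[k] Module.End k (SymAlg b D), IsABMorphism b D η act ∧ IsRecursive b D act := by
  refine ⟨recMorphism h η, ⟨fun x l hl hx => ?_, fun x l hl => ?_⟩, fun x y N hl hxy => ?_⟩
  · rw [recMorphism_eq_stepVal h hη x hl]
    cases l with
    | nil => simp [stepVal]
    | cons y N => rw [stepVal, if_pos (hx y (by simp))]
  · rw [recMorphism, ofValues_apply h _ x hl]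
    exact (approx_close_agree h hη _).1 x _ _ (zMon_mem_filtP η hl le_rfl) (by omega)
  · rw [recMorphism_eq_stepVal h hη x hl, stepVal, if_neg (not_le.mpr hxy)]

end Recursion

/-! ### The adequacy identity as an overlap ambiguity -/

section Overlap

variable {k L ι : Type*} [CommRing k] [AddCommGroup L] [Module k L] [LinearOrder ι]
variable {b : Module.Basis ι k L} {D : Data k L} {q : ι → ι → k} {η : ι → ℕ}
variable {act : L →ₗ[k] Module.End k (SymAlg b D)}

/-- `⟨x, y⟩ + [x, y]` as an operator: what is left of `x · y` after `x` and `y` are exchanged. -/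
def correction (b : Module.Basis ι k L) (D : Data k L)
    (act : L →ₗ[k] Module.End k (SymAlg b D)) (x y : ι) : Module.End k (SymAlg b D) :=
  act2 act (D.pseudo (b x ⊗ₜ[k] b y)) + act (D.bracket (b x ⊗ₜ[k] b y))

namespace RepUpTo

variable {r : ℕ}

theorem apply (hrep : RepUpTo b D η act r) {x y : ι} {p : ℕ} {v : SymAlg b D}
    (hv : v ∈ filtP b D η p) (hr : η x + η y + p ≤ r) :
    act (b x) (act (b y) v) =
      act2 act (D.T (b x ⊗ₜ[k] b y)) v + act (D.bracket (b x ⊗ₜ[k] b y)) v := by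
  have : filtP b D η p ≤ LinearMap.eqLocus (act (b x) * act (b y))
      (act2 act (D.T (b x ⊗ₜ[k] b y)) + act (D.bracket (b x ⊗ₜ[k] b y))) := by
    refine filtP_le fun l hl hp => ?_
    rw [LinearMap.mem_eqLocus, LinearMap.add_apply, ← hrep x y l hl (by omega)]
    simp
  exact this hv

theorem apply_right (hrep : RepUpTo b D η act r) {x : ι} {u : L} {s p : ℕ} {v : SymAlg b D}
    (hu : u ∈ gradedBelow b η s) (hv : v ∈ filtP b D η p) (hr : η x + s + p ≤ r + 1) :
    act (b x) (act u v) =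
      act2 act (D.T (b x ⊗ₜ[k] u)) v + act (D.bracket (b x ⊗ₜ[k] u)) v := by
  have : gradedBelow b η s ≤ LinearMap.eqLocus (act (b x) ∘ₗ act.flip v)
      ((act2 act).flip v ∘ₗ D.T ∘ₗ TensorProduct.mk k L L (b x)
        + act.flip v ∘ₗ D.bracket ∘ₗ TensorProduct.mk k L L (b x)) :=
    gradedBelow_le fun y hy => hrep.apply hv (by omega)
  exact this hu

theorem apply_left (hrep : RepUpTo b D η act r) {x : ι} {u : L} {s p : ℕ} {v : SymAlg b D}
    (hu : u ∈ gradedBelow b η s) (hv : v ∈ filtP b D η p) (hr : s + η x + p ≤ r + 1) :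
    act u (act (b x) v) =
      act2 act (D.T (u ⊗ₜ[k] b x)) v + act (D.bracket (u ⊗ₜ[k] b x)) v := by
  have : gradedBelow b η s ≤ LinearMap.eqLocus (act.flip (act (b x) v))
      ((act2 act).flip v ∘ₗ D.T ∘ₗ (TensorProduct.mk k L L).flip (b x)
        + act.flip v ∘ₗ D.bracket ∘ₗ (TensorProduct.mk k L L).flip (b x)) :=
    gradedBelow_le fun y hy => hrep.apply hv (by omega)
  exact this hu

theorem swap (hrep : RepUpTo b D η act r)
    (hT : D.T = D.S + D.pseudo) (hS : ∀ x y, D.S (b x ⊗ₜ[k] b y) = q x y • (b y ⊗ₜ[k] b x))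
    {x y : ι} {p : ℕ} {v : SymAlg b D} (hv : v ∈ filtP b D η p) (hr : η x + η y + p ≤ r) :
    act (b x) (act (b y) v) =
      q x y • act (b y) (act (b x) v) + correction b D act x y v := by
  rw [hrep.apply hv hr, hT, LinearMap.add_apply, hS, map_add, map_smul, LinearMap.add_apply,
    LinearMap.smul_apply, act2_tmul, correction, LinearMap.add_apply, add_assoc]

end RepUpTo

namespace IsBasicTLieAlgebra

theorem lowersDegree (H : IsBasicTLieAlgebra b D η) : LowersDegree b D η where
  pos := H.η_pos
  bracket x y := H.bracket_stable _ _ _ (basis_mem_gradedPart x) _ (basis_mem_gradedPart y)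
  pseudo x y := H.pseudo_stable _ _ _ (basis_mem_gradedPart x) _ (basis_mem_gradedPart y)

theorem bracket_S (H : IsBasicTLieAlgebra b D η) (t : L ⊗[k] L) :
    D.bracket (D.S t) = -D.bracket t := by
  have h1 := LinearMap.congr_fun H.bracket_T t
  have h2 := LinearMap.congr_fun H.bracket_pseudo t
  simp only [H.T_eq, LinearMap.comp_apply, LinearMap.add_apply, map_add, LinearMap.neg_apply,
    LinearMap.zero_apply] at h1 h2
  rwa [h2, add_zero] at h1

theorem bracket_swap (H : IsBasicTLieAlgebra b D η) (hq : IsQFlip b D q) (x y : ι) :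
    D.bracket (b x ⊗ₜ[k] b y) = -(q x y • D.bracket (b y ⊗ₜ[k] b x)) := by
  have := H.bracket_S (b x ⊗ₜ[k] b y)
  rw [hq.S_basis, map_smul] at this
  rw [this, neg_neg]

/-- Multiplicativity of `S`, with the arguments of the bracket in decreasing order. -/
theorem S_tmul_bracket (H : IsBasicTLieAlgebra b D η) (hq : IsQFlip b D q) {x y w : ι}
    (hyx : y < x) (hwy : w < y) :
    D.S (b w ⊗ₜ[k] D.bracket (b x ⊗ₜ[k] b y)) =
      (q w y * q w x) • (D.bracket (b x ⊗ₜ[k] b y) ⊗ₜ[k] b w) := by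
  have h1 := H.mult_left (x := (b w ⊗ₜ[k] b y) ⊗ₜ[k] b x)
    (Submodule.subset_span ⟨w, y, x, hwy, hyx, rfl⟩)
  simp only [idBr, brId, op12, op23, LinearMap.comp_apply, LinearEquiv.coe_coe,
    TensorProduct.assoc_tmul, LinearMap.lTensor_tmul, LinearMap.rTensor_tmul, hq.S_basis,
    TensorProduct.tmul_smul, ← TensorProduct.smul_tmul', map_smul,
    TensorProduct.assoc_symm_tmul] at h1
  rw [H.bracket_swap hq x y]
  simp only [TensorProduct.tmul_neg, TensorProduct.neg_tmul, TensorProduct.tmul_smul,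
    ← TensorProduct.smul_tmul', map_neg, map_smul] at h1 ⊢
  rw [h1]
  module

theorem S_bracket_tmul (H : IsBasicTLieAlgebra b D η) (hq : IsQFlip b D q) {x y w : ι}
    (hyx : y < x) (hwy : w < y) :
    D.S (D.bracket (b y ⊗ₜ[k] b w) ⊗ₜ[k] b x) =
      (q y x * q w x) • (b x ⊗ₜ[k] D.bracket (b y ⊗ₜ[k] b w)) := by
  have h1 := H.mult_right (x := (b w ⊗ₜ[k] b y) ⊗ₜ[k] b x)
    (Submodule.subset_span ⟨w, y, x, hwy, hyx, rfl⟩)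
  simp only [idBr, brId, op12, op23, LinearMap.comp_apply, LinearEquiv.coe_coe,
    TensorProduct.assoc_tmul, LinearMap.lTensor_tmul, LinearMap.rTensor_tmul, hq.S_basis,
    TensorProduct.tmul_smul, ← TensorProduct.smul_tmul', map_smul,
    TensorProduct.assoc_symm_tmul] at h1
  rw [H.bracket_swap hq y w]
  simp only [TensorProduct.tmul_neg, TensorProduct.neg_tmul, TensorProduct.tmul_smul,
    ← TensorProduct.smul_tmul', map_neg, map_smul] at h1 ⊢
  rw [h1]
  module

theorem jacobi_basis (H : IsBasicTLieAlgebra b D η) (hq : IsQFlip b D q) {x y w : ι}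
    (hyx : y < x) (hwy : w < y) :
    (q y w * q x w) • D.bracket (b w ⊗ₜ[k] D.bracket (b x ⊗ₜ[k] b y))
      - (q x y * q x w) • D.bracket (D.bracket (b y ⊗ₜ[k] b w) ⊗ₜ[k] b x)
      - q x y • D.bracket (b y ⊗ₜ[k] D.bracket (b x ⊗ₜ[k] b w)) = 0 := by
  have h1 := H.jacobi ((b x ⊗ₜ[k] b y) ⊗ₜ[k] b w)
    (Submodule.subset_span ⟨x, y, w, hyx, hwy, rfl⟩)
  simp only [idBr, brId, op12, op23, LinearMap.comp_apply, LinearEquiv.coe_coe,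
    LinearMap.add_apply, LinearMap.sub_apply,
    TensorProduct.assoc_tmul, LinearMap.lTensor_tmul, LinearMap.rTensor_tmul, hq.S_basis,
    TensorProduct.tmul_smul, ← TensorProduct.smul_tmul', map_smul, map_add, map_sub,
    TensorProduct.assoc_symm_tmul] at h1
  rw [H.bracket_swap hq x w]
  simp only [TensorProduct.tmul_neg, TensorProduct.tmul_smul, map_neg, map_smul]
  rw [← h1]
  module

/-- The adequacy identity says that the two ways of rewriting the decreasing word `x · y · w`
agree: multiplicativity of `S` and the Jacobi identity turn one statement into the other. -/
theorem adequacyIdentity_of_overlap (H : IsBasicTLieAlgebra b D η) (hq : IsQFlip b D q)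
    {r : ℕ} (hrep : RepUpTo b D η act r) {x y w : ι} {p : ℕ} {v : SymAlg b D} (hyx : y < x)
    (hwy : w < y) (hv : v ∈ filtP b D η p) (hr : η x + η y + η w + p ≤ r + 1)
    (hoverlap : (q x y * q x w) • correction b D act y w (act (b x) v)
        + q x y • act (b y) (correction b D act x w v) + correction b D act x y (act (b w) v) =
      (q y w * q x w) • act (b w) (correction b D act x y v)
        + q y w • correction b D act x w (act (b y) v)
        + act (b x) (correction b D act y w v)) :
    AdequacyIdentity b D act x y w v := by
  have hD := H.lowersDegree
  have e1 := hrep.apply_right (x := w) (hD.bracket x y) hv (by omega)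
  have e2 := hrep.apply_left (x := x) (hD.bracket y w) hv (by omega)
  have e3 := congrArg (fun u => act u v) (H.jacobi_basis hq hyx hwy)
  rw [H.T_eq, LinearMap.add_apply, H.S_tmul_bracket hq hyx hwy, map_add, map_smul,
    LinearMap.add_apply, LinearMap.smul_apply, act2_tmul] at e1
  rw [H.T_eq, LinearMap.add_apply, H.S_bracket_tmul hq hyx hwy, map_add, map_smul,
    LinearMap.add_apply, LinearMap.smul_apply, act2_tmul] at e2
  simp only [map_sub, map_smul, map_zero, LinearMap.sub_apply, LinearMap.smul_apply,
    LinearMap.zero_apply] at e3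
  have c1 : (q y w * q x w) * (q w y * q w x) = 1 := by
    linear_combination q x w * q w x * hq.mul_swap y w + hq.mul_swap x w
  have c2 : (q x y * q x w) * (q y x * q w x) = 1 := by
    linear_combination q x w * q w x * hq.mul_swap x y + hq.mul_swap x w
  replace e1 := congrArg ((q y w * q x w) • ·) e1
  replace e2 := congrArg ((q x y * q x w) • ·) e2
  simp only [smul_add, smul_smul, c1, c2, one_smul] at e1 e2
  simp only [correction, LinearMap.add_apply, map_add, smul_add] at hoverlap
  simp only [AdequacyIdentity, qCoeff_eq hq.S_basis]
  linear_combination (norm := module) hoverlap + e1 - e2 + e3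

end IsBasicTLieAlgebra

end Overlap

/-! ### Structure constants of `(sl_{n+1}^+)_q` -/

section StructureConstants

variable {n : ℕ} {k : Type*} [CommRing k] (q : kˣ)

theorem slBasis_eq_e (x : Idx n) : slBasis n k x = e n k x.i x.j := by
  rw [e, dif_pos ⟨x.one_le, x.lt, x.le⟩]

theorem slS_basis (x y : Idx n) :
    slS n q (slBasis n k x ⊗ₜ[k] slBasis n k y) =
      slQ q x y • (slBasis n k y ⊗ₜ[k] slBasis n k x) := by
  rw [slS, ← Module.Basis.tensorProduct_apply, Module.Basis.constr_basis]

theorem slPseudo_basis (x y : Idx n) :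
    slPseudo n q (slBasis n k x ⊗ₜ[k] slBasis n k y) = slPseudoFun q x y := by
  rw [slPseudo, ← Module.Basis.tensorProduct_apply, Module.Basis.constr_basis]

theorem slBracket_basis (x y : Idx n) :
    slBracket n q (slBasis n k x ⊗ₜ[k] slBasis n k y) = slBracketFun q x y := by
  rw [slBracket, ← Module.Basis.tensorProduct_apply, Module.Basis.constr_basis]

theorem slQ_of_lt {x y : Idx n} (h : x < y) : slQ q x y = ((q ^ cartan x y : kˣ) : k) :=
  if_pos h

theorem slQ_of_gt {x y : Idx n} (h : y < x) : slQ q x y = ((q ^ (-cartan y x) : kˣ) : k) := by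
  rw [slQ, if_neg h.not_gt, if_pos h]

theorem slQ_self (x : Idx n) : slQ q x x = 1 := by simp [slQ]

theorem slQ_mul_swap (x y : Idx n) : slQ q x y * slQ q y x = 1 := by
  rcases lt_trichotomy x y with h | rfl | h
  · rw [slQ_of_lt q h, slQ_of_gt q h, ← Units.val_mul, ← zpow_add]; simp
  · simp [slQ_self]
  · rw [slQ_of_lt q h, slQ_of_gt q h, ← Units.val_mul, ← zpow_add]; simp

theorem sl_isQFlip : IsQFlip (slBasis n k) (slData n q) (slQ q) where
  S_basis := slS_basis q
  mul_swap := slQ_mul_swap q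
  self := slQ_self q

/-- For distinct basis elements the exponent of `q` depends only on which endpoints are shared,
and not on the diagram order of nested pairs. -/
theorem slQ_eq {x y : Idx n} (h : x ≠ y) : slQ q x y = ((q ^
    (if x.i = y.i then (if x.j < y.j then 1 else -1)
      else if x.j = y.j then (if x.i < y.i then 1 else -1)
      else if x.j = y.i then -1 else if y.j = x.i then 1 else 0 : ℤ) : kˣ) : k) := by
  have hx := x.lt
  have hy := y.lt
  rcases lt_or_gt_of_ne h with h | h
  · rw [slQ_of_lt q h]
    rw [Idx.lt_iff] at h
    congr 2
    unfold cartan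
    split_ifs <;> omega
  · rw [slQ_of_gt q h]
    rw [Idx.lt_iff] at h
    congr 2
    unfold cartan
    split_ifs <;> omega

theorem slBracketFun_eq (x y : Idx n) : slBracketFun q x y =
    if x.j = y.i then e n k x.i y.j
    else if y.j = x.i then (-(q : k)) • e n k y.i x.j else 0 := by
  have hx := x.lt
  have hy := y.lt
  rcases lt_trichotomy x y with h | rfl | h
  · have h' := (Idx.lt_iff x y).mp h
    rw [slBracketFun, if_pos h, classicalBracket]
    split_ifs <;> first | omega | simp
  · rw [slBracketFun, if_neg (lt_irrefl x), if_neg (lt_irrefl x), if_neg hx.ne', if_neg hx.ne']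
  · have h' := (Idx.lt_iff y x).mp h
    rw [slBracketFun, if_neg h.not_gt, if_pos h, classicalBracket]
    split_ifs with h1 h2 <;> first | omega | simp
    rw [slQ_eq q h.ne', if_neg (by omega), if_neg (by omega), if_neg h2, if_pos h1, zpow_one]

theorem slBracket_of_lt {x y : Idx n} (h : x < y) :
    slBracket n q (slBasis n k x ⊗ₜ[k] slBasis n k y) =
      if x.j = y.i then e n k x.i y.j else 0 := by
  have hx := x.lt
  have hy := y.lt
  rw [Idx.lt_iff] at h
  rw [slBracket_basis, slBracketFun_eq, if_neg (by omega : ¬ y.j = x.i)]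

theorem slBracket_of_gt {x y : Idx n} (h : y < x) :
    slBracket n q (slBasis n k x ⊗ₜ[k] slBasis n k y) =
      if y.j = x.i then (-(q : k)) • e n k y.i x.j else 0 := by
  have hx := x.lt
  have hy := y.lt
  rw [Idx.lt_iff] at h
  rw [slBracket_basis, slBracketFun_eq, if_neg (by omega : ¬ x.j = y.i)]

theorem slBracket_e {i j u v : ℕ} (hi : 1 ≤ i) (hij : i < j) (hj : j ≤ n + 1) (hu : 1 ≤ u)
    (huv : u < v) (hv : v ≤ n + 1) : slBracket n q (e n k i j ⊗ₜ[k] e n k u v) =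
      if j = u then e n k i v else if v = i then (-(q : k)) • e n k u j else 0 := by
  have := slBracket_basis q (⟨i, j, hi, hij, hj⟩ : Idx n) ⟨u, v, hu, huv, hv⟩
  rwa [slBracketFun_eq, slBasis_eq_e, slBasis_eq_e] at this

theorem slBracket_swap (x y : Idx n) :
    slBracket n q (slBasis n k x ⊗ₜ[k] slBasis n k y) =
      (-slQ q x y) • slBracket n q (slBasis n k y ⊗ₜ[k] slBasis n k x) := by
  rw [slBracket_basis, slBracket_basis, slBracketFun, slBracketFun]
  rcases lt_trichotomy x y with h | rfl | h
  · rw [if_pos h, if_neg h.not_gt, if_pos h, neg_smul, smul_neg, neg_neg, smul_smul,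
      slQ_mul_swap, one_smul]
  · simp
  · rw [if_neg h.not_gt, if_pos h, if_pos h, neg_smul]

theorem slPseudo_swap (x y : Idx n) :
    slPseudo n q (slBasis n k x ⊗ₜ[k] slBasis n k y) =
      (-slQ q x y) • slPseudo n q (slBasis n k y ⊗ₜ[k] slBasis n k x) := by
  rw [slPseudo_basis, slPseudo_basis, slPseudoFun, slPseudoFun]
  by_cases h1 : x.i < y.i ∧ y.i < x.j ∧ x.j < y.j
  · have hne : x ≠ y := by rintro rfl; omega
    rw [if_pos h1, if_neg (by omega), if_pos h1, slQ_eq q hne, if_neg (by omega),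
      if_neg (by omega), if_neg (by omega), if_neg (by omega)]
    simp only [zpow_zero, Units.val_one]
    module
  · by_cases h2 : y.i < x.i ∧ x.i < y.j ∧ y.j < x.j
    · have hne : x ≠ y := by rintro rfl; omega
      rw [if_neg h1, if_pos h2, if_pos h2, slQ_eq q hne, if_neg (by omega),
        if_neg (by omega), if_neg (by omega), if_neg (by omega)]
      simp only [zpow_zero, Units.val_one]
      module
    · rw [if_neg h1, if_neg h2, if_neg h2, if_neg h1, smul_zero]

theorem slBracket_slPseudo (x y : Idx n) :
    slBracket n q (slPseudo n q (slBasis n k x ⊗ₜ[k] slBasis n k y)) = 0 := by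
  have hx := x.one_le
  have hx' := x.le
  have hy := y.one_le
  have hy' := y.le
  rw [slPseudo_basis, slPseudoFun]
  split_ifs with h1 h2
  · rw [map_smul, slBracket_e q (by omega) (by omega) (by omega) (by omega) (by omega) (by omega),
      if_neg (by omega), if_neg (by omega), smul_zero]
  · rw [map_smul, slBracket_e q (by omega) (by omega) (by omega) (by omega) (by omega) (by omega),
      if_neg (by omega), if_neg (by omega), smul_zero]
  · exact map_zero _

theorem e_mem_gradedBelow {i j s : ℕ} (h : i * (j - i) + 1 ≤ s) :
    e n k i j ∈ gradedBelow (slBasis n k) (slη n) s := by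
  rw [e]
  split_ifs with hij
  · exact basis_mem_gradedBelow h
  · exact Submodule.zero_mem _

theorem e_tmul_e_mem_tensorGradedBelow {i j u v s : ℕ} (h : i * (j - i) + u * (v - u) + 1 ≤ s) :
    e n k i j ⊗ₜ[k] e n k u v ∈ tensorGradedBelow (slBasis n k) (slη n) s := by
  rw [e, e]
  split_ifs with hij huv
  · exact tmul_mem_tensorGradedBelow h
  · simp
  · simp
  · simp

theorem slη_merge_lt {i j v : ℕ} (hij : i < j) (hjv : j < v) :
    i * (v - i) + 1 ≤ i * (j - i) + j * (v - j) := by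
  obtain ⟨a, rfl⟩ := Nat.exists_eq_add_of_lt hij
  obtain ⟨c, rfl⟩ := Nat.exists_eq_add_of_lt hjv
  have h1 : i + a + 1 + c + 1 - i = a + c + 2 := by omega
  have h2 : i + a + 1 - i = a + 1 := by omega
  have h3 : i + a + 1 + c + 1 - (i + a + 1) = c + 1 := by omega
  rw [h1, h2, h3]
  nlinarith [Nat.zero_le (a * c)]

theorem slη_cross_lt {i j u v : ℕ} (hiu : i < u) (huj : u < j) (hjv : j < v) :
    i * (v - i) + u * (j - u) + 1 ≤ i * (j - i) + u * (v - u) := by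
  obtain ⟨a, rfl⟩ := Nat.exists_eq_add_of_lt hiu
  obtain ⟨c, rfl⟩ := Nat.exists_eq_add_of_lt huj
  obtain ⟨d, rfl⟩ := Nat.exists_eq_add_of_lt hjv
  have h1 : i + a + 1 + c + 1 + d + 1 - i = a + c + d + 3 := by omega
  have h2 : i + a + 1 + c + 1 - (i + a + 1) = c + 1 := by omega
  have h3 : i + a + 1 + c + 1 - i = a + c + 2 := by omega
  have h4 : i + a + 1 + c + 1 + d + 1 - (i + a + 1) = c + d + 2 := by omega
  rw [h1, h2, h3, h4]
  nlinarith [Nat.zero_le (a * d)]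

theorem slη_pos (x : Idx n) : 1 ≤ slη n x :=
  Nat.mul_pos x.one_le (Nat.sub_pos_of_lt x.lt)

theorem sl_lowersDegree : LowersDegree (slBasis n k) (slData n q) (slη n) where
  pos := slη_pos
  bracket x y := by
    have hx' := x.lt
    have hy' := y.lt
    change slBracket n q _ ∈ _
    rw [slBracket_basis, slBracketFun_eq, slη, slη]
    split_ifs with h1 h2
    · refine e_mem_gradedBelow ?_
      have := slη_merge_lt (h1 ▸ hx') hy'
      rwa [← h1] at this ⊢
    · refine Submodule.smul_mem _ _ (e_mem_gradedBelow ?_)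
      have := slη_merge_lt (h2 ▸ hy') hx'
      rw [← h2] at this ⊢
      omega
    · exact Submodule.zero_mem _
  pseudo x y := by
    change slPseudo n q _ ∈ _
    rw [slPseudo_basis, slPseudoFun, slη, slη]
    split_ifs with h1 h2
    · exact Submodule.smul_mem _ _
        (e_tmul_e_mem_tensorGradedBelow (slη_cross_lt h1.1 h1.2.1 h1.2.2))
    · refine Submodule.smul_mem _ _ (e_tmul_e_mem_tensorGradedBelow ?_)
      have := slη_cross_lt h2.1 h2.2.1 h2.2.2
      omega
    · exact Submodule.zero_mem _

end StructureConstants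

/-! ### `(sl_{n+1}^+)_q` is a basic T-Lie algebra -/

section GeneralBasis

variable {k L ι : Type*} [CommRing k] [AddCommGroup L] [Module k L]
variable {b : Module.Basis ι k L} {D : Data k L} {η : ι → ℕ}

theorem gradedPart_le {m : ℕ} {W : Submodule k L} (h : ∀ x, η x = m → b x ∈ W) :
    gradedPart b η m ≤ W := by
  refine Submodule.span_le.mpr ?_
  rintro _ ⟨x, hx, rfl⟩
  exact h x hx

theorem isInternal_gradedPart (b : Module.Basis ι k L) (η : ι → ℕ) :
    DirectSum.IsInternal (gradedPart b η) := by
  refine DirectSum.isInternal_submodule_of_iSupIndep_of_iSup_eq_top ?_ ?_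
  · intro m
    have hle : ⨆ (j) (_ : j ≠ m), gradedPart b η j ≤ Submodule.span k (b '' {x | η x ≠ m}) := by
      refine iSup₂_le fun j hj => gradedPart_le fun x hx => ?_
      exact Submodule.subset_span ⟨x, fun h => hj (hx.symm.trans h), rfl⟩
    refine Disjoint.mono_right hle (b.linearIndependent.disjoint_span_image ?_)
    exact Set.disjoint_left.mpr fun x hx hx' => hx' hx
  · rw [eq_top_iff, ← b.span_eq, Submodule.span_le]
    rintro _ ⟨x, rfl⟩
    exact Submodule.mem_iSup_of_mem (η x) (basis_mem_gradedPart x)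

theorem map_tmul_mem_of_gradedPart {M : Type*} [AddCommGroup M] [Module k M]
    {f : L ⊗[k] L →ₗ[k] M} {W : ℕ → Submodule k M}
    (h : ∀ x y, f (b x ⊗ₜ[k] b y) ∈ W (η x + η y)) {m₁ m₂ : ℕ} {u v : L}
    (hu : u ∈ gradedPart b η m₁) (hv : v ∈ gradedPart b η m₂) :
    f (u ⊗ₜ[k] v) ∈ W (m₁ + m₂) := by
  have hv' : ∀ x, η x = m₁ → f (b x ⊗ₜ[k] v) ∈ W (m₁ + m₂) := fun x hx =>
    (gradedPart_le (W := (W (m₁ + m₂)).comap (f ∘ₗ TensorProduct.mk k L L (b x)))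
      fun y hy => by subst hx hy; exact h x y) hv
  exact (gradedPart_le (W := (W (m₁ + m₂)).comap (f ∘ₗ (TensorProduct.mk k L L).flip v)) hv') hu

end GeneralBasis

section BasicTLie

variable {n : ℕ} {k : Type*} [CommRing k] (q : kˣ)

theorem sl_mult_left : Set.EqOn (slS n q ∘ₗ idBr (slBracket n q))
    (brId (slBracket n q) ∘ₗ op23 (slS n q) ∘ₗ op12 (slS n q))
    (increasing3 (slBasis n k) :
      Set ((SlPlus n k ⊗[k] SlPlus n k) ⊗[k] SlPlus n k)) := by
  refine LinearMap.eqOn_span ?_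
  rintro _ ⟨x, y, w, hxy, hyw, rfl⟩
  simp only [idBr, brId, op12, op23, LinearMap.comp_apply, LinearEquiv.coe_coe,
    TensorProduct.assoc_tmul, LinearMap.lTensor_tmul, LinearMap.rTensor_tmul, slS_basis,
    TensorProduct.tmul_smul, ← TensorProduct.smul_tmul', map_smul,
    TensorProduct.assoc_symm_tmul]
  rw [slBracket_basis, slBracketFun_eq]
  have hx := x.lt
  have hy := y.lt
  have hw := w.lt
  have hxy' := (Idx.lt_iff x y).mp hxy
  have hyw' := (Idx.lt_iff y w).mp hyw
  split_ifs with h1 h2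
  · let s : Idx n := ⟨y.i, w.j, y.one_le, by omega, w.le⟩
    have hs : e n k y.i w.j = slBasis n k s := (slBasis_eq_e s).symm
    have hxs : x < s := (Idx.lt_iff x s).mpr (by change x.i + x.j < y.i + w.j ∨ _; omega)
    rw [hs, slS_basis, slQ_of_lt q hxs, slQ_of_lt q hxy, slQ_of_lt q (hxy.trans hyw), smul_smul,
      ← Units.val_mul, ← zpow_add]
    -- The exponent of `q` is additive in the merged index pair.
    congr 4
    simp only [cartan, h1, s]
    ring
  · omega
  · simp

theorem sl_mult_right : Set.EqOn (slS n q ∘ₗ brId (slBracket n q))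
    (idBr (slBracket n q) ∘ₗ op12 (slS n q) ∘ₗ op23 (slS n q))
    (increasing3 (slBasis n k) :
      Set ((SlPlus n k ⊗[k] SlPlus n k) ⊗[k] SlPlus n k)) := by
  refine LinearMap.eqOn_span ?_
  rintro _ ⟨x, y, w, hxy, hyw, rfl⟩
  simp only [idBr, brId, op12, op23, LinearMap.comp_apply, LinearEquiv.coe_coe,
    TensorProduct.assoc_tmul, LinearMap.lTensor_tmul, LinearMap.rTensor_tmul, slS_basis,
    TensorProduct.tmul_smul, ← TensorProduct.smul_tmul', map_smul,
    TensorProduct.assoc_symm_tmul]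
  rw [slBracket_basis, slBracketFun_eq]
  have hx := x.lt
  have hy := y.lt
  have hw := w.lt
  have hxy' := (Idx.lt_iff x y).mp hxy
  have hyw' := (Idx.lt_iff y w).mp hyw
  split_ifs with h1 h2
  · let s : Idx n := ⟨x.i, y.j, x.one_le, by omega, y.le⟩
    have hs : e n k x.i y.j = slBasis n k s := (slBasis_eq_e s).symm
    have hsw : s < w := (Idx.lt_iff s w).mpr (by change x.i + y.j < w.i + w.j ∨ _; omega)
    rw [hs, slS_basis, slQ_of_lt q hsw, slQ_of_lt q hyw, slQ_of_lt q (hxy.trans hyw), smul_smul,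
      ← Units.val_mul, ← zpow_add]
    -- The exponent of `q` is additive in the merged index pair.
    congr 4
    simp only [cartan, ← h1, s]
    ring
  · omega
  · simp

theorem sl_jacobi {x y w : Idx n} (hyx : y < x) (hwy : w < y) :
    (slQ q y w * slQ q x w) • slBracket n q (slBasis n k w ⊗ₜ[k]
        slBracket n q (slBasis n k x ⊗ₜ[k] slBasis n k y))
      + (-(slQ q x y * slQ q x w)) • slBracket n q
        (slBracket n q (slBasis n k y ⊗ₜ[k] slBasis n k w) ⊗ₜ[k] slBasis n k x)
      + (slQ q x y * slQ q x w) • slBracket n q (slBasis n k y ⊗ₜ[k]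
        slBracket n q (slBasis n k w ⊗ₜ[k] slBasis n k x)) = 0 := by
  have hx := x.lt
  have hy := y.lt
  have hw := w.lt
  have hx' := x.le
  have hw' := w.one_le
  have hyx' := (Idx.lt_iff y x).mp hyx
  have hwy' := (Idx.lt_iff w y).mp hwy
  have hy1 := y.one_le
  have hy2 := y.le
  have hx1 := x.one_le
  have hw2 := w.le
  rw [slBracket_of_gt q hyx, slBracket_of_gt q hwy, slBracket_of_lt q (hwy.trans hyx)]
  simp only [slBasis_eq_e]
  split_ifs with h1 h2 h3 h3 h2 h3 h3 <;>
    first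
    | omega
    | simp (disch := omega) only [TensorProduct.tmul_smul, ← TensorProduct.smul_tmul', map_smul,
      TensorProduct.tmul_zero, TensorProduct.zero_tmul, map_zero, smul_zero, add_zero,
      slBracket_e, if_pos, if_neg]
  -- The chain `w.j = y.i`, `y.j = x.i` remains: two of the terms are nonzero, and they cancel.
  have hyw : slQ q y w = slQ q x y := by
    rw [slQ_eq q hwy.ne', slQ_eq q hyx.ne', if_neg (by omega), if_neg (by omega),
      if_neg (by omega), if_pos h2, if_neg (by omega), if_neg (by omega), if_neg (by omega),
      if_pos h1]
  rw [hyw]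
  module

end BasicTLie

section GeneralBasis

variable {k L ι : Type*} [CommRing k] [AddCommGroup L] [Module k L] [LinearOrder ι]
variable {b : Module.Basis ι k L} {D : Data k L} {q : ι → ι → k} {η : ι → ℕ}

/-- The axioms of a basic T-Lie algebra, checked on the basis. -/
theorem IsBasicTLieAlgebra.of_basis (hq : IsQFlip b D q) (hη : LowersDegree b D η)
    (mult_left : Set.EqOn (D.S ∘ₗ idBr D.bracket) (brId D.bracket ∘ₗ op23 D.S ∘ₗ op12 D.S)
      (increasing3 b : Set ((L ⊗[k] L) ⊗[k] L)))
    (mult_right : Set.EqOn (D.S ∘ₗ brId D.bracket) (idBr D.bracket ∘ₗ op12 D.S ∘ₗ op23 D.S)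
      (increasing3 b : Set ((L ⊗[k] L) ⊗[k] L)))
    (T_eq : D.T = D.S + D.pseudo)
    (bracket_swap : ∀ x y, D.bracket (b x ⊗ₜ[k] b y) = (-q x y) • D.bracket (b y ⊗ₜ[k] b x))
    (pseudo_swap : ∀ x y, D.pseudo (b x ⊗ₜ[k] b y) = (-q x y) • D.pseudo (b y ⊗ₜ[k] b x))
    (bracket_pseudo : ∀ x y, D.bracket (D.pseudo (b x ⊗ₜ[k] b y)) = 0)
    (jacobi : ∀ x y w, y < x → w < y →
      (q y w * q x w) • D.bracket (b w ⊗ₜ[k] D.bracket (b x ⊗ₜ[k] b y))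
        + (-(q x y * q x w)) • D.bracket (D.bracket (b y ⊗ₜ[k] b w) ⊗ₜ[k] b x)
        + (q x y * q x w) • D.bracket (b y ⊗ₜ[k] D.bracket (b w ⊗ₜ[k] b x)) = 0) :
    IsBasicTLieAlgebra b D η where
  S_sq := (b.tensorProduct b).ext fun ⟨x, y⟩ => by
    simp only [Module.Basis.tensorProduct_apply, LinearMap.comp_apply, hq.S_basis, map_smul,
      smul_smul, hq.mul_swap, one_smul, LinearMap.id_apply]
  S_basis := ⟨q, hq.S_basis⟩
  mult_left := mult_left
  mult_right := mult_right
  η_pos := hη.pos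
  graded := isInternal_gradedPart b η
  bracket_stable _ _ _ hx _ hy :=
    map_tmul_mem_of_gradedPart (W := gradedBelow b η) hη.bracket hx hy
  pseudo_stable _ _ _ hx _ hy :=
    map_tmul_mem_of_gradedPart (W := tensorGradedBelow b η) hη.pseudo hx hy
  T_eq := T_eq
  bracket_T := (b.tensorProduct b).ext fun ⟨x, y⟩ => by
    simp only [T_eq, Module.Basis.tensorProduct_apply, LinearMap.comp_apply, LinearMap.add_apply,
      map_add, hq.S_basis, map_smul, bracket_pseudo, add_zero, LinearMap.neg_apply]
    rw [bracket_swap x y, neg_smul, neg_neg]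
  pseudo_S := (b.tensorProduct b).ext fun ⟨x, y⟩ => by
    simp only [Module.Basis.tensorProduct_apply, LinearMap.comp_apply, hq.S_basis, map_smul,
      LinearMap.neg_apply]
    rw [pseudo_swap x y, neg_smul, neg_neg]
  bracket_pseudo := (b.tensorProduct b).ext fun ⟨x, y⟩ => by
    simp only [Module.Basis.tensorProduct_apply, LinearMap.comp_apply, bracket_pseudo,
      LinearMap.zero_apply]
  jacobi t ht := by
    refine (Submodule.span_le (p := LinearMap.ker (D.bracket ∘ₗ
      (idBr D.bracket ∘ₗ op12 D.S ∘ₗ op23 D.S - brId D.bracket ∘ₗ op23 D.S ∘ₗ op12 D.S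
        + idBr D.bracket ∘ₗ op23 D.S ∘ₗ op12 D.S))).mpr ?_) ht
    rintro _ ⟨x, y, w, hyx, hwy, rfl⟩
    rw [SetLike.mem_coe, LinearMap.mem_ker, ← jacobi x y w hyx hwy]
    simp only [idBr, brId, op12, op23, LinearMap.comp_apply, LinearEquiv.coe_coe,
      LinearMap.add_apply, LinearMap.sub_apply,
      TensorProduct.assoc_tmul, LinearMap.lTensor_tmul, LinearMap.rTensor_tmul, hq.S_basis,
      TensorProduct.tmul_smul, ← TensorProduct.smul_tmul', map_smul, map_add, map_sub,
      TensorProduct.assoc_symm_tmul]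
    module

end GeneralBasis

theorem sl_isBasicTLieAlgebra (n : ℕ) {k : Type*} [CommRing k] (q : kˣ) :
    IsBasicTLieAlgebra (slBasis n k) (slData n q) (slη n) :=
  .of_basis (sl_isQFlip q) (sl_lowersDegree q) (sl_mult_left q) (sl_mult_right q) rfl
    (slBracket_swap q) (slPseudo_swap q) (slBracket_slPseudo q) fun _ _ _ => sl_jacobi q

/-! ### Overlaps of three quantum root vectors -/

section Overlaps

variable {k V : Type*} [CommRing k] [AddCommGroup V] [Module k V]

/-- The relations between root vectors, applied to the vector `w`, as rules that move the
lexicographically larger index pair to the left. The budget says that `η(i, j) + η(u, v)` and the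
degree `s - s'` of `w` add up to at most `r`, where `η(i, j) = i j - i²`; subtractions are cleared
so that only products of indices occur. -/
structure Straightens (Q Qi : k) (A : ℕ → ℕ → Module.End k V) (r s s' : ℕ) (w : V) : Prop where
  cross : ∀ i u j v, i < u → u < j → j < v → i * j + u * v + s ≤ r + s' + i * i + u * u →
    A i j (A u v w) = A u v (A i j w) + (Q - Qi) • A i v (A u j w)
  merge : ∀ i j v, i < j → j < v → i * j + j * v + s ≤ r + s' + i * i + j * j →
    A i j (A j v w) = Qi • A j v (A i j w) + A i v w
  left : ∀ i j v, i < j → j < v → i * j + i * v + s ≤ r + s' + i * i + i * i →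
    A i j (A i v w) = Q • A i v (A i j w)
  right : ∀ i u j, i < u → u < j → i * j + u * j + s ≤ r + s' + i * i + u * u →
    A i j (A u j w) = Q • A u j (A i j w)
  nested : ∀ i u v j, i < u → u < v → v < j → i * j + u * v + s ≤ r + s' + i * i + u * u →
    A i j (A u v w) = A u v (A i j w)
  disjoint : ∀ i j u v, i < j → j < u → u < v → i * j + u * v + s ≤ r + s' + i * i + u * u →
    A i j (A u v w) = A u v (A i j w)

/-- The relative position of `(i, j) > (u, v)` in the diagram order, with the scalar and the
correction term of the exchange of the two root vectors. -/
inductive PairShape (Q Qi : k) (A : ℕ → ℕ → Module.End k V) (i j u v : ℕ) :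
    k → Module.End k V → Prop
  | disjoint : v < i → PairShape Q Qi A i j u v 1 0
  | merge : v = i → PairShape Q Qi A i j u v Q ((-Q) • A u j)
  | cross : u < i → i < v → v < j → PairShape Q Qi A i j u v 1 ((Qi - Q) • (A u j * A i v))
  | right : u < i → v = j → PairShape Q Qi A i j u v Qi 0
  | left : u = i → v < j → PairShape Q Qi A i j u v Qi 0
  | inner : i < u → v < j → PairShape Q Qi A i j u v 1 0
  | outer : u < i → j < v → PairShape Q Qi A i j u v 1 0

/-- The rearrangement inequality for two pairs: it bounds the degree of a crossed-over word. -/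
theorem mul_swap_lt {a b c d : ℕ} (h : a < b ∧ c < d ∨ b < a ∧ d < c) :
    a * d + b * c + 1 ≤ a * c + b * d := by
  rcases h with ⟨hab, hcd⟩ | ⟨hab, hcd⟩
  · obtain ⟨s, rfl⟩ := Nat.exists_eq_add_of_lt hab
    obtain ⟨t, rfl⟩ := Nat.exists_eq_add_of_lt hcd
    nlinarith [Nat.zero_le (s * t)]
  · obtain ⟨s, rfl⟩ := Nat.exists_eq_add_of_lt hab
    obtain ⟨t, rfl⟩ := Nat.exists_eq_add_of_lt hcd
    nlinarith [Nat.zero_le (s * t)]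

set_option maxHeartbeats 4000000 in
/-- The two ways of rewriting the word `x · y · w` of decreasing root vectors agree. For each
relative position of the six endpoints, both sides are brought to the same normal form: words with
lexicographically decreasing index pairs. All words that occur have lower degree than `x · y · w`,
so that the rules apply. -/
theorem overlap_resolvable {Q Qi : k} (hQ : Q * Qi = 1) {A : ℕ → ℕ → Module.End k V}
    {r p : ℕ} {z : V} (h2 : Straightens Q Qi A r p 0 z)
    (h3 : ∀ a b, a < b → Straightens Q Qi A r (p + a * b) (a * a) (A a b z))
    {i₁ j₁ i₂ j₂ i₃ j₃ : ℕ} (hx : i₁ < j₁) (hy : i₂ < j₂) (hw : i₃ < j₃)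
    (hr : i₁ * j₁ + i₂ * j₂ + i₃ * j₃ + p ≤ r + 1 + i₁ * i₁ + i₂ * i₂ + i₃ * i₃)
    {q₁₂ q₁₃ q₂₃ : k} {C₁₂ C₁₃ C₂₃ : Module.End k V}
    (s₁₂ : PairShape Q Qi A i₁ j₁ i₂ j₂ q₁₂ C₁₂) (s₁₃ : PairShape Q Qi A i₁ j₁ i₃ j₃ q₁₃ C₁₃)
    (s₂₃ : PairShape Q Qi A i₂ j₂ i₃ j₃ q₂₃ C₂₃) :
    (q₁₂ * q₁₃) • C₂₃ (A i₁ j₁ z) + q₁₂ • A i₂ j₂ (C₁₃ z) + C₁₂ (A i₃ j₃ z) =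
      (q₂₃ * q₁₃) • A i₃ j₃ (C₁₂ z) + q₂₃ • C₁₃ (A i₂ j₂ z) + A i₁ j₁ (C₂₃ z) := by
  have cross₂ := h2.cross
  have merge₂ := h2.merge
  have left₂ := h2.left
  have right₂ := h2.right
  have cross₃ := fun a b hab => (h3 a b hab).cross
  have merge₃ := fun a b hab => (h3 a b hab).merge
  have left₃ := fun a b hab => (h3 a b hab).left
  have right₃ := fun a b hab => (h3 a b hab).right
  -- The scalar `1` keeps `simp` from treating these two rules as permutations, which it would
  -- apply in the direction of its own term order.
  have nested₂ := fun i u v j h₁ h₂ h₃ h₄ =>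
    (h2.nested i u v j h₁ h₂ h₃ h₄).trans (one_smul k _).symm
  have disjoint₂ := fun i j u v h₁ h₂ h₃ h₄ =>
    (h2.disjoint i j u v h₁ h₂ h₃ h₄).trans (one_smul k _).symm
  have nested₃ := fun a b hab i u v j h₁ h₂ h₃ h₄ =>
    ((h3 a b hab).nested i u v j h₁ h₂ h₃ h₄).trans (one_smul k _).symm
  have disjoint₃ := fun a b hab i j u v h₁ h₂ h₃ h₄ =>
    ((h3 a b hab).disjoint i j u v h₁ h₂ h₃ h₄).trans (one_smul k _).symm
  clear h2 h3
  have g₁ := Nat.mul_le_mul_left i₁ hx.le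
  have g₂ := Nat.mul_le_mul_left i₂ hy.le
  have g₃ := Nat.mul_le_mul_left i₃ hw.le
  cases s₁₂ <;> cases s₁₃ <;> cases s₂₃ <;>
    first
    | omega
    | (simp only [LinearMap.zero_apply, map_zero, smul_zero, add_zero]; done)
    | skip
  -- The degrees of the words differ by products of differences of endpoints.
  all_goals first
    | have f₁₂₁₂ := mul_swap_lt (a := i₁) (b := i₂) (c := j₁) (d := j₂) (by omega)
    | have f₁₂₁₂ := mul_swap_lt (a := i₂) (b := i₁) (c := j₁) (d := j₂) (by omega)
    | skip
  all_goals first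
    | have f₁₂₁₃ := mul_swap_lt (a := i₁) (b := i₂) (c := j₁) (d := j₃) (by omega)
    | have f₁₂₁₃ := mul_swap_lt (a := i₂) (b := i₁) (c := j₁) (d := j₃) (by omega)
    | skip
  all_goals first
    | have f₁₂₂₃ := mul_swap_lt (a := i₁) (b := i₂) (c := j₂) (d := j₃) (by omega)
    | have f₁₂₂₃ := mul_swap_lt (a := i₂) (b := i₁) (c := j₂) (d := j₃) (by omega)
    | skip
  all_goals first
    | have f₁₃₁₂ := mul_swap_lt (a := i₁) (b := i₃) (c := j₁) (d := j₂) (by omega)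
    | have f₁₃₁₂ := mul_swap_lt (a := i₃) (b := i₁) (c := j₁) (d := j₂) (by omega)
    | skip
  all_goals first
    | have f₁₃₁₃ := mul_swap_lt (a := i₁) (b := i₃) (c := j₁) (d := j₃) (by omega)
    | have f₁₃₁₃ := mul_swap_lt (a := i₃) (b := i₁) (c := j₁) (d := j₃) (by omega)
    | skip
  all_goals first
    | have f₁₃₂₃ := mul_swap_lt (a := i₁) (b := i₃) (c := j₂) (d := j₃) (by omega)
    | have f₁₃₂₃ := mul_swap_lt (a := i₃) (b := i₁) (c := j₂) (d := j₃) (by omega)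
    | skip
  all_goals first
    | have f₂₃₁₂ := mul_swap_lt (a := i₂) (b := i₃) (c := j₁) (d := j₂) (by omega)
    | have f₂₃₁₂ := mul_swap_lt (a := i₃) (b := i₂) (c := j₁) (d := j₂) (by omega)
    | skip
  all_goals first
    | have f₂₃₁₃ := mul_swap_lt (a := i₂) (b := i₃) (c := j₁) (d := j₃) (by omega)
    | have f₂₃₁₃ := mul_swap_lt (a := i₃) (b := i₂) (c := j₁) (d := j₃) (by omega)
    | skip
  all_goals first
    | have f₂₃₂₃ := mul_swap_lt (a := i₂) (b := i₃) (c := j₂) (d := j₃) (by omega)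
    | have f₂₃₂₃ := mul_swap_lt (a := i₃) (b := i₂) (c := j₂) (d := j₃) (by omega)
    | skip
  all_goals try have g₁₂ := Nat.mul_le_mul_left i₁ (show i₁ ≤ j₂ by omega)
  all_goals try have g₁₃ := Nat.mul_le_mul_left i₁ (show i₁ ≤ j₃ by omega)
  all_goals try have g₂₁ := Nat.mul_le_mul_left i₂ (show i₂ ≤ j₁ by omega)
  all_goals try have g₂₃ := Nat.mul_le_mul_left i₂ (show i₂ ≤ j₃ by omega)
  all_goals try have g₃₁ := Nat.mul_le_mul_left i₃ (show i₃ ≤ j₁ by omega)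
  all_goals try have g₃₂ := Nat.mul_le_mul_left i₃ (show i₃ ≤ j₂ by omega)
  all_goals subst_vars
  all_goals simp (disch := omega) only [LinearMap.zero_apply, map_zero, smul_zero, add_zero,
    zero_add, LinearMap.smul_apply, Module.End.mul_apply, map_smul, map_add, smul_add,
    cross₂, merge₂, left₂, right₂, nested₂, disjoint₂,
    cross₃, merge₃, left₃, right₃, nested₃, disjoint₃]
  -- Both sides are in normal form, and it remains to compare the coefficients of the words.
  all_goals clear * - hQ
  all_goals match_scalars <;> grind

end Overlaps

/-! ### `(sl_{n+1}^+)_q` is adequate -/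

section Adequacy

variable {n : ℕ} {k : Type*} [CommRing k] (q : kˣ)
variable {act : SlPlus n k →ₗ[k] Module.End k (SymAlg (slBasis n k) (slData n q))}

theorem sl_correction (x y : Idx n) :
    correction (slBasis n k) (slData n q) act x y =
      act2 act (slPseudoFun q x y) + act (slBracketFun q x y) := by
  rw [← slPseudo_basis, ← slBracket_basis]
  rfl

/-- The scalar and the correction term in the exchange of two basis elements. -/
theorem sl_pairShape {x y : Idx n} (h : y < x) :
    PairShape (q : k) ((q⁻¹ : kˣ) : k) (fun i j => act (e n k i j)) x.i x.j y.i y.j (slQ q x y)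
      (correction (slBasis n k) (slData n q) act x y) := by
  have hx := x.lt
  have hy := y.lt
  have h' := (Idx.lt_iff y x).mp h
  have hmul : ∀ u v, act2 act (u ⊗ₜ[k] v) = act u * act v := fun u v =>
    LinearMap.ext fun w => act2_tmul act u v w
  rw [slQ_eq q h.ne', sl_correction, slPseudoFun, slBracketFun_eq]
  rcases lt_trichotomy y.j x.i with h1 | h1 | h1
  · simp (disch := omega) only [if_neg, map_zero, add_zero, zpow_zero, Units.val_one]
    exact .disjoint h1
  · simp (disch := omega) only [if_neg, if_pos, map_zero, zero_add, zpow_one, map_smul]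
    exact .merge h1
  · rcases lt_trichotomy y.i x.i with h2 | h2 | h2
    · rcases lt_trichotomy y.j x.j with h3 | h3 | h3
      · simp (disch := omega) only [if_neg, if_pos, map_zero, add_zero, zpow_zero,
          Units.val_one, map_smul, hmul]
        exact .cross h2 h1 h3
      · simp (disch := omega) only [if_neg, if_pos, map_zero, add_zero, zpow_neg_one]
        exact .right h2 h3
      · simp (disch := omega) only [if_neg, map_zero, add_zero, zpow_zero,
          Units.val_one]
        exact .outer h2 h3
    · simp (disch := omega) only [if_neg, if_pos, map_zero, add_zero, zpow_neg_one]
      exact .left h2 (by omega)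
    · simp (disch := omega) only [if_neg, map_zero, add_zero, zpow_zero,
        Units.val_one]
      exact .inner h2 (by omega)

/-- In low degree, a morphism with the representation property exchanges root vectors as the
relations of the enveloping algebra prescribe. The relations hold for all natural indices: `e` is
zero at the pairs that are out of range, and then both sides vanish. -/
theorem sl_straightens {r : ℕ} (hrep : RepUpTo (slBasis n k) (slData n q) (slη n) act r)
    {s s' p : ℕ} (hs : s = p + s') {w : SymAlg (slBasis n k) (slData n q)}
    (hw : w ∈ filtP (slBasis n k) (slData n q) (slη n) p) :
    Straightens (q : k) ((q⁻¹ : kˣ) : k) (fun i j => act (e n k i j)) r s s' w := by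
  have hzero : ∀ {i j : ℕ}, ¬ (1 ≤ i ∧ j ≤ n + 1) → act (e n k i j) = 0 := by
    intro i j h
    rw [e, dif_neg (by tauto), map_zero]
  have hexch : ∀ {i j u v : ℕ}, 1 ≤ i → i < j → j ≤ n + 1 → 1 ≤ u → u < v → v ≤ n + 1 →
      (i ≠ u ∨ j ≠ v) → i * j + u * v + s ≤ r + s' + i * i + u * u →
      act (e n k i j) (act (e n k u v) w) =
        ((q ^ (if i = u then (if j < v then 1 else -1)
          else if j = v then (if i < u then 1 else -1)
          else if j = u then -1 else if v = i then 1 else 0 : ℤ) : kˣ) : k) •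
            act (e n k u v) (act (e n k i j) w)
          + ((if i < u ∧ u < j ∧ j < v then ((q : k) - ((q⁻¹ : kˣ) : k)) •
                act (e n k i v) (act (e n k u j) w)
              else if u < i ∧ i < v ∧ v < j then (((q⁻¹ : kˣ) : k) - (q : k)) •
                act (e n k u j) (act (e n k i v) w)
              else 0)
            + (if j = u then act (e n k i v) w
              else if v = i then (-(q : k)) • act (e n k u j) w else 0)) := by
    intro i j u v hi hij hj hu huv hv hne hr
    have hx := Nat.mul_sub i j i
    have hy := Nat.mul_sub u v u
    have hx' := Nat.mul_le_mul_left i hij.le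
    have hy' := Nat.mul_le_mul_left u huv.le
    have := hrep.swap rfl (slS_basis q) (x := ⟨i, j, hi, hij, hj⟩) (y := ⟨u, v, hu, huv, hv⟩) hw
      (by simp only [slη]; omega)
    rw [sl_correction, LinearMap.add_apply, slBasis_eq_e, slBasis_eq_e,
      slQ_eq q (by rw [ne_eq, Idx.ext_iff]; simp only; omega), slPseudoFun, slBracketFun_eq] at this
    rw [this]
    simp only
    congr 2
    · split_ifs
      · rw [map_smul, LinearMap.smul_apply, act2_tmul]
      · rw [map_smul, LinearMap.smul_apply, act2_tmul]
      · rw [map_zero, LinearMap.zero_apply]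
    · split_ifs
      · rfl
      · rw [map_smul, LinearMap.smul_apply]
      · rw [map_zero, LinearMap.zero_apply]
  constructor
  · intro i u j v hiu huj hjv hr
    by_cases h : 1 ≤ i ∧ v ≤ n + 1
    · rw [hexch h.1 (by omega) (by omega) (by omega) (by omega) h.2 (by omega) hr,
        if_neg (by omega), if_neg (by omega), if_neg (by omega), if_neg (by omega),
        if_pos ⟨hiu, huj, hjv⟩, if_neg (by omega), if_neg (by omega), zpow_zero, Units.val_one,
        one_smul, add_zero]
    · rcases not_and_or.mp h with h1 | h1
      · simp [hzero (i := i) (fun h => h1 h.1)]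
      · simp [hzero (j := v) (fun h => h1 h.2)]
  · intro i j v hij hjv hr
    by_cases h : 1 ≤ i ∧ v ≤ n + 1
    · rw [hexch h.1 (by omega) (by omega) (by omega) (by omega) h.2 (by omega) hr,
        if_neg (by omega), if_neg (by omega), if_pos rfl, if_neg (by omega), if_neg (by omega),
        if_pos rfl, zpow_neg_one, zero_add]
    · rcases not_and_or.mp h with h1 | h1
      · simp [hzero (i := i) (fun h => h1 h.1)]
      · simp [hzero (j := v) (fun h => h1 h.2)]
  · intro i j v hij hjv hr
    by_cases h : 1 ≤ i ∧ v ≤ n + 1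
    · rw [hexch h.1 (by omega) (by omega) (by omega) (by omega) h.2 (by omega) hr,
        if_pos rfl, if_pos hjv, if_neg (by omega), if_neg (by omega), if_neg (by omega),
        if_neg (by omega), zpow_one, add_zero, add_zero]
    · rcases not_and_or.mp h with h1 | h1
      · simp [hzero (i := i) (fun h => h1 h.1)]
      · simp [hzero (j := v) (fun h => h1 h.2)]
  · intro i u j hiu huj hr
    by_cases h : 1 ≤ i ∧ j ≤ n + 1
    · rw [hexch h.1 (by omega) (by omega) (by omega) (by omega) h.2 (by omega) hr,
        if_neg (by omega), if_pos rfl, if_pos hiu, if_neg (by omega), if_neg (by omega),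
        if_neg (by omega), if_neg (by omega), zpow_one, add_zero, add_zero]
    · rcases not_and_or.mp h with h1 | h1
      · simp [hzero (i := i) (fun h => h1 h.1)]
      · simp [hzero (j := j) (fun h => h1 h.2)]
  · intro i u v j hiu huv hvj hr
    by_cases h : 1 ≤ i ∧ j ≤ n + 1
    · rw [hexch h.1 (by omega) (by omega) (by omega) (by omega) (by omega) (by omega) hr,
        if_neg (by omega), if_neg (by omega), if_neg (by omega), if_neg (by omega),
        if_neg (by omega), if_neg (by omega), if_neg (by omega), if_neg (by omega), zpow_zero,
        Units.val_one, one_smul, add_zero, add_zero]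
    · simp [hzero h]
  · intro i j u v hij hju huv hr
    by_cases h : 1 ≤ i ∧ v ≤ n + 1
    · rw [hexch h.1 (by omega) (by omega) (by omega) (by omega) h.2 (by omega) hr,
        if_neg (by omega), if_neg (by omega), if_neg (by omega), if_neg (by omega),
        if_neg (by omega), if_neg (by omega), if_neg (by omega), if_neg (by omega), zpow_zero,
        Units.val_one, one_smul, add_zero, add_zero]
    · rcases not_and_or.mp h with h1 | h1
      · simp [hzero (i := i) (fun h => h1 h.1)]
      · simp [hzero (j := v) (fun h => h1 h.2)]

theorem sl_isAdequate (n : ℕ) {k : Type*} [CommRing k] (q : kˣ) :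
    IsAdequate (slBasis n k) (slData n q) (slη n) where
  exists_morphism := exists_recursive_morphism (sl_isQFlip q) (sl_lowersDegree q)
  identity act hAB r hrep x y w N hyx hwy hN _ hr := by
    have hv : zMon (slBasis n k) (slData n q) N ∈
        filtP (slBasis n k) (slData n q) (slη n) (degree (slη n) N) :=
      zMon_mem_filtP (slη n) hN le_rfl
    refine (sl_isBasicTLieAlgebra n q).adequacyIdentity_of_overlap (sl_isQFlip q) hrep hyx hwy hv
      hr ?_
    simp only [slBasis_eq_e]
    refine overlap_resolvable (A := fun i j => act (e n k i j)) (Units.mul_inv q)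
      (sl_straightens q hrep rfl hv) (fun i j hij => ?_) x.lt y.lt w.lt ?_
      (sl_pairShape q hyx) (sl_pairShape q (hwy.trans hyx)) (sl_pairShape q hwy)
    · have hd := Nat.mul_sub i j i
      have hd' := Nat.mul_le_mul_left i hij.le
      refine sl_straightens q hrep (p := i * (j - i) + degree (slη n) N) (by omega) ?_
      by_cases h : 1 ≤ i ∧ i < j ∧ j ≤ n + 1
      · have := (hAB.closeBelow _).mem (sl_isQFlip q) (x := ⟨i, j, h.1, h.2.1, h.2.2⟩) hv
          (Nat.lt_succ_self _)
        rwa [slBasis_eq_e] at this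
      · rw [e, dif_neg h, map_zero]
        exact Submodule.zero_mem _
    · have hx := Nat.mul_sub x.i x.j x.i
      have hy := Nat.mul_sub y.i y.j y.i
      have hw := Nat.mul_sub w.i w.j w.i
      have hx' := Nat.mul_le_mul_left x.i x.lt.le
      have hy' := Nat.mul_le_mul_left y.i y.lt.le
      have hw' := Nat.mul_le_mul_left w.i w.lt.le
      simp only [slη] at hr
      omega

end Adequacy

end TLie

theorem mainTheorem4 (K : Type*) [Field K] [CharZero K] (n : ℕ) :
    TLie.IsBasicTLieAlgebra (TLie.slBasis n (TLie.QRing K))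
        (TLie.slData n (TLie.qExp K)) (TLie.slη n) ∧
      TLie.IsAdequate (TLie.slBasis n (TLie.QRing K))
        (TLie.slData n (TLie.qExp K)) (TLie.slη n) :=
  ⟨TLie.sl_isBasicTLieAlgebra n _, TLie.sl_isAdequate n _⟩

end
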